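/- Let $N\ge 2$ and let $\Omega\subset\mathbb R^N$ be a bounded Lipschitz domain (bounded, open, connected, nonempty, and near every boundary point, in suitable orthonormal coordinates, the region above the graph of a Lipschitz function). Let $\partial\Omega=\Sigma_{\mathcal D}\cup\Sigma_{\mathcal N}$ with $\Sigma_{\mathcal D}\cap\Sigma_{\mathcal N}=\emptyset$, where $\Sigma_{\mathcal D}$ is closed and $0<\mathcal H^{N-1}(\Sigma_{\mathcal D})<\mathcal H^{N-1}(\partial\Omega)$. Let $H^1_{\Sigma_{\mathcal D}}(\Omega)$ be the closure in $H^1(\Omega)$ of $C_c^\infty(\Omega\cup\Sigma_{\mathcal N})$, i.e. of the restrictions to $\Omega$ of the functions in $C_c^\infty(\mathbb R^N)$ whose support does not meet $\Sigma_{\mathcal D}$. For $\lambda>0$, call $\varphi\in H^1_{\Sigma_{\mathcal D}}(\Omega)$ a solution of the mixed eigenvalue problem $$-\Delta\varphi=\lambda\varphi\ \text{ in }\Omega,\qquad \varphi=0\ \text{ on }\Sigma_{\mathcal D},\qquad \frac{\partial\varphi}{\partial\nu}=0\ \text{ on }\Sigma_{\mathcal N}$$ if $\int_\Omega\nabla\varphi\cdot\nabla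 v\,dx=\lambda\int_\Omega\varphi v\,dx$ for all $v\in H^1_{\Sigma_{\mathcal D}}(\Omega)$. Write $\|\cdot\|_p$ for the norm of $L^p(\Omega)$. 1. For every $\lambda>0$, every solution $\varphi$ belongs to $L^\infty(\Omega)$. 2. For every $p_0\in(1,\infty)$ there is a constant $C>0$, depending only on $p_0$, $\Omega$ and $\Sigma_{\mathcal D}$, such that for every $\lambda>0$ and every solution $\varphi$, $$\|\varphi\|_\infty\le C\,\lambda^{\frac{N}{2p_0}}\,\|\varphi\|_{p_0}.$$ 3. If $N\ge3$, the dependence of the constant on $\Omega$ and $\Sigma_{\mathcal D}$ is only through the mixed Sobolev constant: for every $p_0\in(1,\infty)$ there is $C=C(N,p_0)>0$ such that for all $\Omega,\Sigma_{\mathcal D},\Sigma_{\mathcal N}$ as above there is some $\kappa>0$ with $$\kappa\,\|u\|_{\frac{2N}{N-2}}\le\|\nabla u\|_2\quad\text{for all }u\in H^1_{\Sigma_{\mathcal D}}(\Omega),$$ and, for every $\kappa>0$ with this property, every $\lambda>0$ and every solution $\varphi$, $$\|\varphi\|_\infty\le C(N,p_0)\left(\frac{\lambda}{\kappa^2}\right)^{\frac{N}{2p_0}}\|\varphi\|_{p_0}.$$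 -/

import Mathlib

open MeasureTheory
open scoped ENNReal NNReal ContDiff Gradient

/-- A bounded Lipschitz domain in `ℝᴺ`: a bounded, open, connected (nonempty) set such that near
each boundary point, in suitable orthonormal coordinates whose last axis is the unit vector `e`,
the set is the region above the graph of a Lipschitz function `γ` of the remaining coordinates
(`y - ⟪y, e⟫ e` is the projection of `y` on the hyperplane orthogonal to `e`). -/
structure IsBoundedLipschitzDomain {N : ℕ} (Ω : Set (EuclideanSpace ℝ (Fin N))) : Prop where
  isOpen : IsOpen Ω
  isConnected : IsConnected Ω
  isBounded : Bornology.IsBounded Ω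
  lipschitz_boundary : ∀ x ∈ frontier Ω,
    ∃ (e : EuclideanSpace ℝ (Fin N)) (K : ℝ≥0) (γ : EuclideanSpace ℝ (Fin N) → ℝ) (r : ℝ),
      ‖e‖ = 1 ∧ LipschitzWith K γ ∧ 0 < r ∧
        ∀ y ∈ Metric.ball x r, (y ∈ Ω ↔ γ (y - inner ℝ y e • e) < inner ℝ y e)

/-- The geometric setting of the mixed boundary value problem: a bounded Lipschitz domain whose
boundary is the disjoint union of a closed Dirichlet part `SD` and a Neumann part `SN`, with
`0 < |SD| < |∂Ω|` for the `(N - 1)`-dimensional (Hausdorff) surface measure. -/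
structure IsMixedDomain {N : ℕ} (Ω SD SN : Set (EuclideanSpace ℝ (Fin N))) : Prop where
  domain : IsBoundedLipschitzDomain Ω
  union_eq : SD ∪ SN = frontier Ω
  disjoint : Disjoint SD SN
  isClosed_dirichlet : IsClosed SD
  surface_pos : 0 < μH[(N : ℝ) - 1] SD
  surface_lt : μH[(N : ℝ) - 1] SD < μH[(N : ℝ) - 1] (frontier Ω)

/-- `u ∈ H¹(Ω)` with weak gradient `G`: both are square integrable on `Ω`, and
`∫_Ω u ∇ψ = - ∫_Ω ψ G` for all `ψ ∈ C_c^∞(Ω)`. -/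
structure MemH1 {N : ℕ} (Ω : Set (EuclideanSpace ℝ (Fin N)))
    (u : EuclideanSpace ℝ (Fin N) → ℝ)
    (G : EuclideanSpace ℝ (Fin N) → EuclideanSpace ℝ (Fin N)) : Prop where
  memLp : MemLp u 2 (volume.restrict Ω)
  memLp_grad : MemLp G 2 (volume.restrict Ω)
  weak_gradient : ∀ ψ : EuclideanSpace ℝ (Fin N) → ℝ,
    ContDiff ℝ ∞ ψ → HasCompactSupport ψ → tsupport ψ ⊆ Ω →
      ∫ x in Ω, u x • ∇ ψ x = - ∫ x in Ω, ψ x • G x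

/-- `u ∈ H¹_{SD}(Ω)` with weak gradient `G`: `u` belongs to the closure in `H¹(Ω)` of
`C_c^∞(Ω ∪ SN)`, the restrictions to `Ω` of the smooth compactly supported functions on `ℝᴺ`
whose support does not meet `SD`. -/
structure MemH1Mixed {N : ℕ} (Ω SD : Set (EuclideanSpace ℝ (Fin N)))
    (u : EuclideanSpace ℝ (Fin N) → ℝ)
    (G : EuclideanSpace ℝ (Fin N) → EuclideanSpace ℝ (Fin N)) : Prop where
  memH1 : MemH1 Ω u G
  approx : ∀ ε : ℝ≥0∞, 0 < ε → ∃ ψ : EuclideanSpace ℝ (Fin N) → ℝ,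
    ContDiff ℝ ∞ ψ ∧ HasCompactSupport ψ ∧ Disjoint (tsupport ψ) SD ∧
      eLpNorm (fun x => u x - ψ x) 2 (volume.restrict Ω) < ε ∧
      eLpNorm (fun x => G x - ∇ ψ x) 2 (volume.restrict Ω) < ε

/-- `φ ∈ H¹_{SD}(Ω)` is a (weak) solution of `-Δφ = lam φ` in `Ω`, `φ = 0` on `SD`, `∂φ/∂ν = 0` on
`SN = ∂Ω ∖ SD`: one has `∫_Ω ∇φ · ∇v = lam ∫_Ω φ v` for all `v ∈ H¹_{SD}(Ω)`. -/
def IsMixedEigenSolution {N : ℕ} (Ω SD : Set (EuclideanSpace ℝ (Fin N))) (lam : ℝ)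
    (φ : EuclideanSpace ℝ (Fin N) → ℝ) : Prop :=
  ∃ G : EuclideanSpace ℝ (Fin N) → EuclideanSpace ℝ (Fin N), MemH1Mixed Ω SD φ G ∧
    ∀ (v : EuclideanSpace ℝ (Fin N) → ℝ)
      (H : EuclideanSpace ℝ (Fin N) → EuclideanSpace ℝ (Fin N)), MemH1Mixed Ω SD v H →
      ∫ x in Ω, inner ℝ (G x) (H x) = lam * ∫ x in Ω, φ x * v x

/-- The Sobolev inequality for mixed boundary conditions (meant for `N ≥ 3`) holds with constant
`κ`: `κ ‖u‖_{2N/(N-2)} ≤ ‖∇u‖_2` for all `u ∈ H¹_{SD}(Ω)`. The largest such `κ` is the Sobolev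
constant relative to `SD`. -/
def MixedSobolevInequality {N : ℕ} (Ω SD : Set (EuclideanSpace ℝ (Fin N))) (κ : ℝ) : Prop :=
  ∀ (u : EuclideanSpace ℝ (Fin N) → ℝ)
    (G : EuclideanSpace ℝ (Fin N) → EuclideanSpace ℝ (Fin N)), MemH1Mixed Ω SD u G →
    ENNReal.ofReal κ * eLpNorm u (ENNReal.ofReal (2 * N / ((N : ℝ) - 2))) (volume.restrict Ω)
      ≤ eLpNorm G 2 (volume.restrict Ω)

/-! ### Integration along segments and a Poincaré inequality on balls. -/

section Translation

open Set

variable {E : Type*} [NormedAddCommGroup E] [NormedSpace ℝ E]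

/-! The bound comes from Moser iteration. Let `F` be a smooth truncation of `t |t| ^ (q - 1)` and
let `H` be the primitive of `(F')²` with `H 0 = 0`. Testing the weak equation with `H ∘ φ` gives
`‖∇(F ∘ φ)‖₂² = lam ∫ φ H(φ) ≤ lam q² ‖φ‖_{2q}^{2q}` (`eLpNorm_deriv_smul_le_of_weak`). Inserting `F
∘ φ` in a Gagliardo-Nirenberg inequality `‖u‖_{2χ} ≤ K ‖u‖₂^{1-s} ‖∇u‖₂^s` and removing the
truncation yields, with `p = 2q`, `‖φ‖_{χp} ≤ (K lam^{s/2} p)^{2/p} ‖φ‖_p`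
(`IsMixedEigenSolution.eLpNorm_le`). Along `p = p₀ χⁿ` the product of the factors converges, and
`lam` receives the exponent `(s/2)(2/p₀) χ/(χ-1)`. For `N ≥ 3`, `χ = N/(N-2)` and `s = 1`; for `N =
2`, `χ = 2` and `s = 1/2`. Both choices give `N/(2p₀)`. For `p₀ < 2` the iteration starts at `2`,
and interpolation between `L^{p₀}` and `L^∞` finishes (`exists_eLpNorm_top_le`).

The functional inequalities are proved on the domain itself, without an extension operator. Near
each point of `closure Ω` some basis consists of directions along which one stays in `Ω`, so
Gagliardo's argument works with half-lines and bounds the local `L^{N/(N-1)}` norm by the `W^{1,1}`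
norm (`exists_setLIntegral_ball_rpow_le`). A Poincaré inequality then absorbs the `L¹` term
(`IsMixedDomain.isGradientControlled`): a portion of `SD` of positive surface measure, swept into
`Ω`, covers positive volume, where `ψ` is controlled by integrating from its zeros; connectedness
spreads this control over `Ω`. Applying the `W^{1,1}` inequality to powers `|ψ|^t` gives the `L²`
versions. -/

/-- A `C¹` function is controlled along a segment by its value at the other endpoint and the
integral of its derivative over the open segment. -/
theorem enorm_le_enorm_add_lintegral_fderiv {ψ : E → ℝ} (hψ : ContDiff ℝ 1 ψ) (x e : E) {T : ℝ}
    (hT : 0 ≤ T) :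
    ‖ψ x‖ₑ ≤ ‖ψ (x + T • e)‖ₑ + ‖e‖ₑ * ∫⁻ s in Ioo 0 T, ‖fderiv ℝ ψ (x + s • e)‖ₑ := by
  have hc : Continuous fun s : ℝ => fderiv ℝ ψ (x + s • e) :=
    (hψ.continuous_fderiv one_ne_zero).comp (by fun_prop)
  have hd : ∀ s : ℝ, HasDerivAt (fun s : ℝ => ψ (x + s • e)) (fderiv ℝ ψ (x + s • e) e) s := by
    intro s
    have h1 : HasDerivAt (fun s : ℝ => x + s • e) e s := by
      simpa using ((hasDerivAt_id s).smul_const e).const_add x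
    exact ((hψ.differentiable one_ne_zero) (x + s • e)).hasFDerivAt.comp_hasDerivAt s h1
  have hi : ∫ s in (0 : ℝ)..T, fderiv ℝ ψ (x + s • e) e = ψ (x + T • e) - ψ x := by
    rw [intervalIntegral.integral_eq_sub_of_hasDerivAt (fun s _ => hd s)
      ((hc.clm_apply continuous_const).intervalIntegrable _ _)]
    simp
  have h2 : ψ x = ψ (x + T • e) - ∫ s in (0 : ℝ)..T, fderiv ℝ ψ (x + s • e) e := by
    rw [hi]; ring
  calc ‖ψ x‖ₑ ≤ ‖ψ (x + T • e)‖ₑ + ‖∫ s in (0 : ℝ)..T, fderiv ℝ ψ (x + s • e) e‖ₑ := by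
        conv_lhs => rw [h2]
        exact enorm_sub_le
    _ ≤ ‖ψ (x + T • e)‖ₑ + ∫⁻ s in Ioo 0 T, ‖fderiv ℝ ψ (x + s • e) e‖ₑ := by
        gcongr
        rw [intervalIntegral.integral_of_le hT, integral_Ioc_eq_integral_Ioo]
        exact enorm_integral_le_lintegral_enorm _
    _ ≤ ‖ψ (x + T • e)‖ₑ + ∫⁻ s in Ioo 0 T, ‖e‖ₑ * ‖fderiv ℝ ψ (x + s • e)‖ₑ := by
        gcongr with s
        rw [mul_comm]
        exact ContinuousLinearMap.le_opENorm _ _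
    _ = _ := by
        rw [lintegral_const_mul _ hc.measurable.enorm]

variable [MeasurableSpace E] [BorelSpace E] [FiniteDimensional ℝ E] (μ : Measure E)
  [μ.IsAddHaarMeasure]

theorem lintegral_lintegral_translate {G : E → ℝ≥0∞} (hG : Measurable G) (a e : E) (T : ℝ) :
    ∫⁻ x, (∫⁻ s in Ioo 0 T, G (x + a + s • e)) ∂μ = ENNReal.ofReal T * ∫⁻ x, G x ∂μ := by
  rw [lintegral_lintegral_swap (by
    apply Measurable.aemeasurable
    exact hG.comp (by fun_prop))]
  have : ∀ s : ℝ, ∫⁻ x, G (x + a + s • e) ∂μ = ∫⁻ x, G x ∂μ := by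
    intro s
    simp_rw [add_assoc]
    exact lintegral_add_right_eq_self G _
  simp_rw [this]
  simp [mul_comm]

/-- Integrate the one-dimensional bound over `A`. As the segments stay in `Ω`, the derivative may be
cut off outside `Ω`; Fubini and translation invariance then turn the double integral into `T` times
one integral over `Ω`. -/
theorem setLIntegral_enorm_translate_le {ψ : E → ℝ} (hψ : ContDiff ℝ 1 ψ) {Ω A : Set E}
    (hΩ : MeasurableSet Ω) (hA : MeasurableSet A) (a e : E) {T : ℝ} (hT : 0 ≤ T)
    (h : ∀ x ∈ A, ∀ s ∈ Ioo 0 T, x + a + s • e ∈ Ω) :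
    ∫⁻ x in A, ‖ψ (x + a)‖ₑ ∂μ ≤ ∫⁻ x in A, ‖ψ (x + a + T • e)‖ₑ ∂μ +
      ‖e‖ₑ * (ENNReal.ofReal T * ∫⁻ x in Ω, ‖fderiv ℝ ψ x‖ₑ ∂μ) := by
  have hG : Measurable (Ω.indicator fun x => ‖fderiv ℝ ψ x‖ₑ) :=
    (hψ.continuous_fderiv one_ne_zero).measurable.enorm.indicator hΩ
  have hm : Measurable fun x : E => ‖ψ (x + a + T • e)‖ₑ :=
    (hψ.continuous.comp (by fun_prop)).measurable.enorm
  calc ∫⁻ x in A, ‖ψ (x + a)‖ₑ ∂μ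
      ≤ ∫⁻ x in A, (‖ψ (x + a + T • e)‖ₑ + ‖e‖ₑ * ∫⁻ s in Ioo 0 T,
          Ω.indicator (fun x => ‖fderiv ℝ ψ x‖ₑ) (x + a + s • e)) ∂μ := by
        refine setLIntegral_mono' hA fun x hx => ?_
        refine (enorm_le_enorm_add_lintegral_fderiv hψ (x + a) e hT).trans ?_
        gcongr 1
        gcongr 1
        refine setLIntegral_mono' measurableSet_Ioo fun s hs => ?_
        rw [indicator_of_mem (h x hx s hs)]
    _ = ∫⁻ x in A, ‖ψ (x + a + T • e)‖ₑ ∂μ + ∫⁻ x in A, ‖e‖ₑ * (∫⁻ s in Ioo 0 T,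
          Ω.indicator (fun x => ‖fderiv ℝ ψ x‖ₑ) (x + a + s • e)) ∂μ := lintegral_add_left hm _
    _ ≤ ∫⁻ x in A, ‖ψ (x + a + T • e)‖ₑ ∂μ + ∫⁻ x, ‖e‖ₑ * (∫⁻ s in Ioo 0 T,
          Ω.indicator (fun x => ‖fderiv ℝ ψ x‖ₑ) (x + a + s • e)) ∂μ := by
        gcongr; exact Measure.restrict_le_self
    _ = _ := by
        rw [lintegral_const_mul' _ _ enorm_ne_top, lintegral_lintegral_translate μ hG,
          lintegral_indicator hΩ]

/-- A Poincaré inequality on a ball in terms of the integral over a subset of positive measure. -/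
theorem measure_mul_setLIntegral_ball_le {ψ : E → ℝ} (hψ : ContDiff ℝ 1 ψ) {Ω A : Set E}
    (hΩ : MeasurableSet Ω) (hA : MeasurableSet A) {z : E} {r : ℝ}
    (hz : Metric.ball z (3 * r) ⊆ Ω) (hAz : A ⊆ Metric.ball z r) :
    μ A * ∫⁻ x in Metric.ball z r, ‖ψ x‖ₑ ∂μ ≤ μ (Metric.ball 0 (2 * r)) *
      (∫⁻ x in A, ‖ψ x‖ₑ ∂μ + ENNReal.ofReal (2 * r) * ∫⁻ x in Ω, ‖fderiv ℝ ψ x‖ₑ ∂μ) := by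
  have hm : Measurable fun p : E × E => ‖ψ (p.1 + p.2)‖ₑ :=
    (hψ.continuous.comp (by fun_prop)).measurable.enorm
  calc μ A * ∫⁻ x in Metric.ball z r, ‖ψ x‖ₑ ∂μ
      = ∫⁻ x in A, ∫⁻ y in Metric.ball z r, ‖ψ y‖ₑ ∂μ ∂μ := by simp [mul_comm]
    _ ≤ ∫⁻ x in A, ∫⁻ h in Metric.ball 0 (2 * r), ‖ψ (x + h)‖ₑ ∂μ ∂μ := by
        refine setLIntegral_mono' hA fun x hx => ?_
        rw [← lintegral_indicator measurableSet_ball, ← lintegral_indicator measurableSet_ball,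
          ← lintegral_add_left_eq_self _ x]
        refine lintegral_mono fun h => ?_
        by_cases hh : x + h ∈ Metric.ball z r
        · rw [indicator_of_mem hh, indicator_of_mem]
          have h1 := hAz hx
          rw [Metric.mem_ball, dist_eq_norm] at h1 hh
          rw [mem_ball_zero_iff]
          calc ‖h‖ = ‖(x + h - z) - (x - z)‖ := by congr 1; abel
            _ ≤ _ := norm_sub_le _ _
            _ < _ := by linarith
        · rw [indicator_of_notMem hh]; exact zero_le
    _ = ∫⁻ h in Metric.ball 0 (2 * r), ∫⁻ x in A, ‖ψ (x + h)‖ₑ ∂μ ∂μ :=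
        lintegral_lintegral_swap hm.aemeasurable
    _ ≤ ∫⁻ h in Metric.ball 0 (2 * r), (∫⁻ x in A, ‖ψ x‖ₑ ∂μ +
          ENNReal.ofReal (2 * r) * ∫⁻ x in Ω, ‖fderiv ℝ ψ x‖ₑ ∂μ) ∂μ := by
        refine setLIntegral_mono' measurableSet_ball fun h hh => ?_
        rw [mem_ball_zero_iff] at hh
        -- With `a = h`, `e = -h` and `T = 1` the segment returns from `x + h` to `x ∈ A`. It stays
        -- in the ball of radius `r + 2r = 3r`.
        refine (setLIntegral_enorm_translate_le μ hψ hΩ hA h (-h) zero_le_one ?_).trans ?_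
        · intro x hx s hs
          apply hz
          have h1 := hAz hx
          rw [Metric.mem_ball, dist_eq_norm] at h1 ⊢
          calc ‖x + h + s • -h - z‖ = ‖(x - z) + (1 - s) • h‖ := by congr 1; module
            _ ≤ ‖x - z‖ + (1 - s) * ‖h‖ := by
              refine (norm_add_le _ _).trans ?_
              rw [norm_smul, Real.norm_of_nonneg (by linarith [hs.2])]
            _ < 3 * r := by nlinarith [norm_nonneg h, hs.1, hs.2]
        · simp only [one_smul, add_neg_cancel_right, enorm_neg, ENNReal.ofReal_one, one_mul]
          gcongr
          rw [← ofReal_norm]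
          exact ENNReal.ofReal_le_ofReal hh.le
    _ = _ := by simp [mul_comm]

end Translation

/-! ### Inward directions of Lipschitz domains, and surface measure versus swept volume. -/

section Geometry

open Set Metric

variable {E : Type*} [NormedAddCommGroup E]

/-- `v` points into `Ω` near `x`: moving from a point of `closure Ω` in the direction `v` leads
into `Ω` as long as one stays in `ball x r`. -/
def IsInwardDirection [NormedSpace ℝ E] (Ω : Set E) (x : E) (r : ℝ) (v : E) : Prop :=
  ∀ y ∈ closure Ω, y ∈ ball x r → ∀ s : ℝ, 0 < s → y + s • v ∈ ball x r → y + s • v ∈ Ω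

variable [InnerProductSpace ℝ E]

theorem LipschitzWith.le_inner_of_mem_closure_epigraph {Ω : Set E} {x e : E} {K : ℝ≥0} {γ : E → ℝ}
    {r : ℝ} (hγ : LipschitzWith K γ)
    (h : ∀ y ∈ ball x r, (y ∈ Ω ↔ γ (y - inner ℝ y e • e) < inner ℝ y e)) {y : E}
    (hy : y ∈ closure Ω) (hyr : y ∈ ball x r) : γ (y - inner ℝ y e • e) ≤ inner ℝ y e := by
  have h1 : y ∈ closure (ball x r ∩ Ω) := isOpen_ball.inter_closure ⟨hyr, hy⟩
  have hc : IsClosed {y : E | γ (y - inner ℝ y e • e) ≤ inner ℝ y e} :=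
    isClosed_le (hγ.continuous.comp (by fun_prop)) (by fun_prop)
  exact closure_minimal (fun z hz => ((h z hz.1).1 hz.2).le) hc h1

theorem LipschitzWith.eq_inner_of_mem_frontier_epigraph {Ω : Set E} (hΩ : IsOpen Ω) {x e : E}
    {K : ℝ≥0} {γ : E → ℝ} {r : ℝ} (hγ : LipschitzWith K γ)
    (h : ∀ y ∈ ball x r, (y ∈ Ω ↔ γ (y - inner ℝ y e • e) < inner ℝ y e)) {y : E}
    (hy : y ∈ frontier Ω) (hyr : y ∈ ball x r) : γ (y - inner ℝ y e • e) = inner ℝ y e := by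
  refine le_antisymm (hγ.le_inner_of_mem_closure_epigraph h (frontier_subset_closure hy) hyr) ?_
  by_contra! hlt
  exact (hΩ.frontier_eq ▸ hy).2 ((h y hyr).2 hlt)

/-- Along `v` the height over the hyperplane grows at rate `⟪v, e⟫`, while `γ` grows at rate at most
`K` times the norm of the tangential part. The weak inequality valid on the closure thus becomes
strict at once. -/
theorem LipschitzWith.isInwardDirection_epigraph {Ω : Set E} {x e : E} {K : ℝ≥0} {γ : E → ℝ}
    {r : ℝ} (hγ : LipschitzWith K γ)
    (h : ∀ y ∈ ball x r, (y ∈ Ω ↔ γ (y - inner ℝ y e • e) < inner ℝ y e)) {v : E}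
    (hv : K * ‖v - inner ℝ v e • e‖ < inner ℝ v e) : IsInwardDirection Ω x r v := by
  intro y hy hyr s hs hysr
  have h1 := hγ.le_inner_of_mem_closure_epigraph h hy hyr
  refine (h _ hysr).2 ?_
  have h2 := hγ.dist_le_mul (y + s • v - inner ℝ (y + s • v) e • e) (y - inner ℝ y e • e)
  have h3 : y + s • v - inner ℝ (y + s • v) e • e - (y - inner ℝ y e • e)
      = s • (v - inner ℝ v e • e) := by
    rw [inner_add_left, real_inner_smul_left]; module
  rw [dist_eq_norm, dist_eq_norm, h3, norm_smul, Real.norm_of_nonneg hs.le] at h2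
  have h4 := (le_abs_self _).trans h2
  rw [inner_add_left, real_inner_smul_left] at *
  nlinarith

/-- Near each point of the closure of a Lipschitz domain there is a basis of inward directions. -/
theorem IsBoundedLipschitzDomain.exists_basis_isInwardDirection {N : ℕ}
    {Ω : Set (EuclideanSpace ℝ (Fin N))} (hΩ : IsBoundedLipschitzDomain Ω)
    {x : EuclideanSpace ℝ (Fin N)} (hx : x ∈ closure Ω) :
    ∃ r : ℝ, 0 < r ∧ ∃ b : Module.Basis (Fin N) ℝ (EuclideanSpace ℝ (Fin N)),
      ∀ i, IsInwardDirection Ω x r (b i) := by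
  by_cases hxΩ : x ∈ Ω
  · obtain ⟨r, hr, hrΩ⟩ := Metric.isOpen_iff.1 hΩ.isOpen x hxΩ
    exact ⟨r, hr, (EuclideanSpace.basisFun (Fin N) ℝ).toBasis, fun i y _ _ s _ h => hrΩ h⟩
  · obtain ⟨e, K, γ, r, he, hγ, hr, h⟩ := hΩ.lipschitz_boundary x
      (hΩ.isOpen.frontier_eq ▸ ⟨hx, hxΩ⟩)
    -- This cone of inward directions is open and contains `e`, hence spans the space, and a basis
    -- can be extracted from it.
    set c : Set (EuclideanSpace ℝ (Fin N)) :=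
      {v | K * ‖v - inner ℝ v e • e‖ < inner ℝ v e} with hc
    have hco : IsOpen c := isOpen_lt (by fun_prop) (by fun_prop)
    have hec : e ∈ c := by simp [hc, he]
    have hspan : ⊤ ≤ Submodule.span ℝ c := by
      refine (Submodule.eq_top_of_nonempty_interior' _ ⟨e, ?_⟩).ge
      exact interior_mono Submodule.subset_span (hco.interior_eq.symm ▸ hec)
    let b := Module.Basis.ofSpan hspan
    have hb := Module.Basis.ofSpan_subset hspan
    have hfin := FiniteDimensional.fintypeBasisIndex b
    have hcard := Module.finrank_eq_card_basis b
    rw [finrank_euclideanSpace] at hcard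
    refine ⟨r, hr, b.reindex (Fintype.equivOfCardEq hcard.symm), fun i => ?_⟩
    apply hγ.isInwardDirection_epigraph h
    rw [Module.Basis.reindex_apply]
    exact hb (mem_range_self _)

/-- Over each point of the projection of `S`, the vertical fibre of `A` contains an interval of
length `c - a`. If `A` is null, Fubini makes the projection null, and `S` lies in its image under
the Lipschitz graph map. -/
theorem hausdorffMeasure_eq_zero_of_volume_eq_zero {n : ℕ}
    {e : EuclideanSpace ℝ (Fin (n + 1))} (he : ‖e‖ = 1) {K : ℝ≥0}
    {γ : EuclideanSpace ℝ (Fin (n + 1)) → ℝ} (hγ : LipschitzWith K γ)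
    {S A : Set (EuclideanSpace ℝ (Fin (n + 1)))}
    (hS : ∀ x ∈ S, γ (x - inner ℝ x e • e) = inner ℝ x e) {a c : ℝ} (hac : a < c)
    (hA : ∀ x ∈ S, ∀ s ∈ Icc a c, x + s • e ∈ A) (hvol : volume A = 0) :
    μH[(n : ℝ)] S = 0 := by
  obtain ⟨b, hb⟩ := Orthonormal.exists_orthonormalBasis_extension_of_card_eq
    (𝕜 := ℝ) (E := EuclideanSpace ℝ (Fin (n + 1))) (ι := Fin (n + 1)) (by simp)
    (v := fun _ => e) (s := {0}) (by
      rw [orthonormal_iff_ite]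
      rintro ⟨i, hi⟩ ⟨j, hj⟩
      rw [mem_singleton_iff] at hi hj
      subst hi; subst hj
      simp [Set.domRestrict, he])
  have hb0 : b 0 = e := hb 0 rfl
  let J : (Fin n → ℝ) →L[ℝ] EuclideanSpace ℝ (Fin (n + 1)) :=
    ∑ i : Fin n, (ContinuousLinearMap.proj (R := ℝ) (φ := fun _ : Fin n => ℝ) i).smulRight (b i.succ)
  have hJ : ∀ y, J y = ∑ i : Fin n, y i • b i.succ := by
    intro y; simp [J]
  let T : (Fin n → ℝ) × ℝ → EuclideanSpace ℝ (Fin (n + 1)) := fun p => p.2 • e + J p.1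
  have hT : MeasurePreserving T volume volume := by
    have h1 := (((LinearIsometryEquiv.measurePreserving b.repr.symm).comp
      (PiLp.volume_preserving_toLp (Fin (n + 1)))).comp
      ((volume_preserving_piFinSuccAbove (fun _ : Fin (n + 1) => ℝ) 0).symm)).comp
      (Measure.measurePreserving_swap (μ := (volume : Measure (Fin n → ℝ)))
        (ν := (volume : Measure ℝ)))
    refine (congrArg (fun f => MeasurePreserving f volume volume) ?_).mp h1
    funext p
    simp [T, hJ, ← b.sum_repr_symm, Fin.sum_univ_succ, hb0]
  have hnull : (volume : Measure ((Fin n → ℝ) × ℝ)) (T ⁻¹' A) = 0 :=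
    hT.quasiMeasurePreserving.preimage_null hvol
  have hslice := Measure.measure_ae_null_of_prod_null hnull
  have hP : volume {y : Fin n → ℝ | ∃ t : ℝ, T (y, t) ∈ S} = 0 := by
    refine measure_mono_null ?_ hslice
    rintro y ⟨t, ht⟩ h0
    have h1 : Icc (t + a) (t + c) ⊆ Prod.mk y ⁻¹' (T ⁻¹' A) := by
      intro s hs
      have h2 := hA _ ht (s - t) ⟨by linarith [hs.1], by linarith [hs.2]⟩
      have h3 : T (y, t) + (s - t) • e = T (y, s) := by simp only [T]; module
      rwa [h3] at h2
    have h4 := measure_mono_null h1 h0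
    rw [Real.volume_Icc, ENNReal.ofReal_eq_zero] at h4
    linarith
  -- `Fin n → ℝ` carries the sup metric, for which Hausdorff and Lebesgue measure coincide; the
  -- change of metric is absorbed in the Lipschitz constant of the graph map.
  have hPH : μH[(n : ℝ)] {y : Fin n → ℝ | ∃ t : ℝ, T (y, t) ∈ S} = 0 := by
    have := hausdorffMeasure_pi_real (ι := Fin n)
    rw [Fintype.card_fin] at this
    rw [this, hP]
  have hg : LipschitzWith (‖ContinuousLinearMap.toSpanSingleton ℝ e‖₊ * (K * ‖J‖₊) + ‖J‖₊)
      (fun y => γ (J y) • e + J y) :=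
    ((ContinuousLinearMap.toSpanSingleton ℝ e).lipschitz.comp (hγ.comp J.lipschitz)).add
      J.lipschitz
  have hsub : S ⊆ (fun y => γ (J y) • e + J y) '' {y : Fin n → ℝ | ∃ t : ℝ, T (y, t) ∈ S} := by
    intro x hx
    have hxe : x = inner ℝ x e • e + J (fun i => inner ℝ (b i.succ) x) := by
      conv_lhs => rw [← b.sum_repr' x, Fin.sum_univ_succ, hb0, real_inner_comm]
      rw [hJ]
    have h1 : J (fun i => inner ℝ (b i.succ) x) = x - inner ℝ x e • e := by
      rw [eq_sub_iff_add_eq', ← hxe]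
    refine ⟨fun i => inner ℝ (b i.succ) x, ⟨inner ℝ x e, ?_⟩, ?_⟩
    · simp only [T]; rwa [← hxe]
    · simp only; rw [h1, hS x hx]; abel
  refine measure_mono_null hsub ?_
  have := hg.hausdorffMeasure_image_le (d := n) (by positivity)
    {y : Fin n → ℝ | ∃ t : ℝ, T (y, t) ∈ S}
  rw [hPH, mul_zero] at this
  exact le_antisymm this zero_le

end Geometry

/-! ### The `L¹` Poincaré inequality for functions vanishing on the Dirichlet part. -/

section Poincare

open Set Metric

variable {E : Type*} [NormedAddCommGroup E] [NormedSpace ℝ E] [MeasurableSpace E]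

/-- The `L¹` norm on `S` of the `C¹` functions vanishing on `D` is controlled by the `L¹` norm of
their gradient on `Ω`. -/
def IsGradientControlled (μ : Measure E) (Ω D S : Set E) : Prop :=
  ∃ C : ℝ≥0, ∀ ψ : E → ℝ, ContDiff ℝ 1 ψ → (∀ x ∈ D, ψ x = 0) →
    ∫⁻ x in S, ‖ψ x‖ₑ ∂μ ≤ C * ∫⁻ x in Ω, ‖fderiv ℝ ψ x‖ₑ ∂μ

namespace IsGradientControlled

variable {μ : Measure E} {Ω D S S' : Set E}

theorem empty : IsGradientControlled μ Ω D ∅ := ⟨0, fun ψ _ _ => by simp⟩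

theorem mono (h : IsGradientControlled μ Ω D S) (hS : S' ⊆ S) : IsGradientControlled μ Ω D S' := by
  obtain ⟨C, hC⟩ := h
  exact ⟨C, fun ψ h1 h2 => (lintegral_mono_set hS).trans (hC ψ h1 h2)⟩

theorem union (h : IsGradientControlled μ Ω D S) (h' : IsGradientControlled μ Ω D S') :
    IsGradientControlled μ Ω D (S ∪ S') := by
  obtain ⟨C, hC⟩ := h
  obtain ⟨C', hC'⟩ := h'
  refine ⟨C + C', fun ψ h1 h2 => (lintegral_union_le _ _ _).trans ?_⟩
  rw [ENNReal.coe_add, add_mul]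
  exact add_le_add (hC ψ h1 h2) (hC' ψ h1 h2)

variable [BorelSpace E] [FiniteDimensional ℝ E] [μ.IsAddHaarMeasure]

/-- The averaging inequality `measure_mul_setLIntegral_ball_le` may be divided by `μ S`, which is
neither zero nor infinite. -/
theorem ball (hΩ : MeasurableSet Ω) (h : IsGradientControlled μ Ω D S) (hS : MeasurableSet S)
    {z : E} {r : ℝ} (hz : Metric.ball z (3 * r) ⊆ Ω) (hSz : S ⊆ Metric.ball z r) (hμ : μ S ≠ 0) :
    IsGradientControlled μ Ω D (Metric.ball z r) := by
  obtain ⟨C, hC⟩ := h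
  have hμ' : μ S ≠ ⊤ := measure_ne_top_of_subset hSz measure_ball_lt_top.ne
  refine ⟨(((μ S)⁻¹ * (μ (Metric.ball 0 (2 * r)) * (C + ENNReal.ofReal (2 * r))))).toNNReal,
    fun ψ h1 h2 => ?_⟩
  rw [ENNReal.coe_toNNReal]
  swap
  · have := (measure_ball_lt_top (μ := μ) (x := (0 : E)) (r := 2 * r)).ne
    finiteness
  have h3 := measure_mul_setLIntegral_ball_le μ h1 hΩ hS hz hSz
  rw [mul_assoc, mul_comm, ← div_eq_mul_inv, ENNReal.le_div_iff_mul_le (Or.inl hμ) (Or.inl hμ'),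
    mul_comm]
  refine h3.trans ?_
  rw [mul_assoc, add_mul]
  gcongr
  exact hC ψ h1 h2

/-- Serves to reach the boundary, around which no ball fits in `Ω`: points of `S` are pushed inside
along `a`, at the cost of one gradient integral. -/
theorem translate (hΩ : MeasurableSet Ω) {a : E} (hS : MeasurableSet S) {τ : ℝ} (hτ : 0 ≤ τ)
    (hS' : ∀ x ∈ S, x + τ • a ∈ S') (h' : IsGradientControlled μ Ω D S')
    (hseg : ∀ x ∈ S, ∀ s ∈ Ioo 0 τ, x + s • a ∈ Ω) : IsGradientControlled μ Ω D S := by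
  obtain ⟨C, hC⟩ := h'
  refine ⟨C + ‖a‖₊ * τ.toNNReal, fun ψ h1 h2 => ?_⟩
  have h3 := setLIntegral_enorm_translate_le μ h1 hΩ hS 0 a hτ (by simpa using hseg)
  simp only [add_zero] at h3
  refine h3.trans ?_
  rw [ENNReal.coe_add, add_mul, ENNReal.coe_mul, mul_assoc]
  refine add_le_add ?_ le_rfl
  refine le_trans ?_ (hC ψ h1 h2)
  have h4 : ∫⁻ x in S, ‖ψ (x + τ • a)‖ₑ ∂μ ≤
      ∫⁻ x in (fun x => x + τ • a) ⁻¹' S', ‖ψ (x + τ • a)‖ₑ ∂μ := lintegral_mono_set hS'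
  refine h4.trans (le_of_eq ?_)
  exact (measurePreserving_add_right μ (τ • a)).setLIntegral_comp_preimage_emb
    (measurableEmbedding_addRight _) (fun x => ‖ψ x‖ₑ) S'

/-- **Poincaré inequality** for functions whose `L¹` norm on a subset of positive measure is
controlled. -/
theorem domain (hΩ : IsOpen Ω) (hc : IsPreconnected Ω) (hb : Bornology.IsBounded Ω)
    (hbd : ∀ x ∈ frontier Ω, ∃ r > 0, ∃ v, IsInwardDirection Ω x r v)
    (h : IsGradientControlled μ Ω D S) (hS : MeasurableSet S) (hSΩ : S ⊆ Ω) (hμ : μ S ≠ 0) :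
    IsGradientControlled μ Ω D Ω := by
  -- `U` is open, nonempty and relatively closed in `Ω`, so it is all of `Ω` by connectedness.
  set U : Set E := {z | z ∈ Ω ∧ ∃ ρ > 0, IsGradientControlled μ Ω D (Metric.ball z ρ)} with hU
  have hΩm := hΩ.measurableSet
  have hUo : IsOpen U := by
    rw [Metric.isOpen_iff]
    rintro z ⟨hz, ρ, hρ, hzρ⟩
    obtain ⟨ρ', hρ', hzρ'⟩ := Metric.isOpen_iff.1 hΩ z hz
    refine ⟨min (ρ / 2) ρ', by positivity, fun w hw => ?_⟩
    refine ⟨hzρ' (ball_subset_ball (min_le_right _ _) hw), ρ / 2, by positivity, hzρ.mono ?_⟩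
    apply ball_subset_ball'
    have := (mem_ball.1 hw).le.trans (min_le_left _ _)
    linarith
  have hne : (Ω ∩ U).Nonempty := by
    obtain ⟨z, hz, hz0⟩ : ∃ z ∈ S, ∀ u ∈ nhdsWithin z S, μ u ≠ 0 := by
      by_contra! hcon
      exact hμ (measure_null_of_locally_null S hcon)
    obtain ⟨r, hr, hrΩ⟩ := Metric.isOpen_iff.1 hΩ z (hSΩ hz)
    refine ⟨z, hSΩ hz, hSΩ hz, r / 3, by positivity, ?_⟩
    refine (h.mono inter_subset_left).ball (S := S ∩ Metric.ball z (r / 3)) hΩm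
      (hS.inter measurableSet_ball) (by rwa [mul_div_cancel₀ _ (by norm_num)]) inter_subset_right ?_
    exact hz0 _ (inter_mem_nhdsWithin _ (ball_mem_nhds z (by positivity)))
  have hcl : closure U ∩ Ω ⊆ U := by
    rintro z ⟨hzU, hz⟩
    obtain ⟨r, hr, hrΩ⟩ := Metric.isOpen_iff.1 hΩ z hz
    -- A ball around `w` of radius at most `r / 6` lies in `ball z (r / 3)`, whose tripled radius
    -- `r` is still admissible.
    obtain ⟨w, ⟨hw, ρ, hρ, hwρ⟩, hzw⟩ := Metric.mem_closure_iff.1 hzU (r / 6) (by positivity)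
    refine ⟨hz, r / 3, by positivity, ?_⟩
    refine (hwρ.mono (ball_subset_ball (min_le_left ρ (r / 6)))).ball hΩm measurableSet_ball
      (by rwa [mul_div_cancel₀ _ (by norm_num)]) ?_ (measure_ball_pos μ _ (by positivity)).ne'
    apply ball_subset_ball'
    have := min_le_right ρ (r / 6)
    rw [dist_comm] at hzw
    linarith
  have hΩU : Ω ⊆ U := hc.subset_of_closure_inter_subset hUo hne hcl
  have hcompact : IsCompact (closure Ω) := hb.isCompact_closure
  have key : IsGradientControlled μ Ω D (closure Ω ∩ Ω) := by
    refine hcompact.induction_on (p := fun t => IsGradientControlled μ Ω D (t ∩ Ω))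
      (by simpa using empty) (fun s t hst ht => ht.mono (inter_subset_inter_left _ hst))
      (fun s t hs ht => by rw [union_inter_distrib_right]; exact hs.union ht) fun x hx => ?_
    by_cases hxΩ : x ∈ Ω
    · obtain ⟨-, ρ, hρ, hxρ⟩ := hΩU hxΩ
      exact ⟨_, mem_nhdsWithin_of_mem_nhds (ball_mem_nhds x hρ), hxρ.mono inter_subset_left⟩
    · obtain ⟨r, hr, v, hv⟩ := hbd x (hΩ.frontier_eq ▸ ⟨hx, hxΩ⟩)
      -- Chosen so that `τ * ‖v‖ < r / 2`: shifts of the half ball stay in `ball x r`. The `+ 1`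
      -- keeps the denominator positive when `v = 0`.
      set τ := r / (2 * (‖v‖ + 1)) with hτ
      have hτ0 : 0 < τ := by positivity
      have hτv : τ * ‖v‖ < r / 2 := by
        rw [hτ, div_mul_eq_mul_div, div_lt_div_iff₀ (by positivity) (by positivity)]
        nlinarith [norm_nonneg v]
      have hmem : ∀ y ∈ Metric.ball x (r / 2), ∀ s, 0 ≤ s → s ≤ τ → y + s • v ∈ Metric.ball x r := by
        intro y hy s hs hsτ
        rw [mem_ball, dist_eq_norm] at hy ⊢
        calc ‖y + s • v - x‖ = ‖(y - x) + s • v‖ := by congr 1; abel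
          _ ≤ ‖y - x‖ + s * ‖v‖ := by
            refine (norm_add_le _ _).trans ?_
            rw [norm_smul, Real.norm_of_nonneg hs]
          _ < r := by nlinarith [norm_nonneg v]
      have hxτ : x + τ • v ∈ Ω := hv x hx (mem_ball_self hr) τ hτ0
        (hmem x (mem_ball_self (by positivity)) τ hτ0.le le_rfl)
      obtain ⟨-, ρ, hρ, hxρ⟩ := hΩU hxτ
      refine ⟨_, mem_nhdsWithin_of_mem_nhds (ball_mem_nhds x (lt_min hρ (half_pos hr))), ?_⟩
      refine translate hΩm (a := v) (measurableSet_ball.inter hΩm) hτ0.le ?_ hxρ ?_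
      · intro y hy
        have := (mem_ball.1 hy.1).trans_le (min_le_left _ _)
        rwa [mem_ball, dist_add_right]
      · intro y hy s hs
        have h2 : y ∈ Metric.ball x (r / 2) := ball_subset_ball (min_le_right _ _) hy.1
        exact hv y (subset_closure hy.2) (ball_subset_ball (by linarith) h2) s hs.1
          (hmem y h2 s hs.1.le hs.2.le)
  exact key.mono (subset_inter subset_closure le_rfl)

end IsGradientControlled

/-- **Poincaré inequality** for the functions vanishing on the Dirichlet part of the boundary. -/
theorem IsMixedDomain.isGradientControlled {n : ℕ}
    {Ω SD SN : Set (EuclideanSpace ℝ (Fin (n + 1)))} (h : IsMixedDomain Ω SD SN) :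
    IsGradientControlled volume Ω SD Ω := by
  have hΩ := h.domain.isOpen
  have hpos := h.surface_pos
  rw [Nat.cast_add, Nat.cast_one, add_sub_cancel_right] at hpos
  have hSDf : SD ⊆ frontier Ω := h.union_eq ▸ subset_union_left
  obtain ⟨x, hx, hx0⟩ : ∃ x ∈ SD, ∀ u ∈ nhdsWithin x SD, μH[(n : ℝ)] u ≠ 0 := by
    by_contra! hcon
    exact hpos.ne' (measure_null_of_locally_null SD hcon)
  obtain ⟨e, K, γ, r, he, hγ, hr, hch⟩ := h.domain.lipschitz_boundary x (hSDf hx)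
  set S := SD ∩ closedBall x (r / 4) with hS
  have hScpt : IsCompact S := (isCompact_closedBall x (r / 4)).inter_left h.isClosed_dirichlet
  have hSpos : μH[(n : ℝ)] S ≠ 0 :=
    hx0 _ (inter_mem_nhdsWithin _ (closedBall_mem_nhds x (by positivity)))
  have hin : IsInwardDirection Ω x r e := hγ.isInwardDirection_epigraph hch (by simp [he])
  have hSball : S ⊆ ball x r := fun y hy =>
    closedBall_subset_ball (show r / 4 < r by linarith) hy.2
  have hmem : ∀ y ∈ S, ∀ s : ℝ, 0 < s → s ≤ r / 4 → y + s • e ∈ Ω := by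
    intro y hy s hs hsr
    refine hin y (frontier_subset_closure (hSDf hy.1)) (hSball hy) s hs ?_
    have hy2 := mem_closedBall.1 hy.2
    rw [dist_eq_norm] at hy2
    rw [mem_ball, dist_eq_norm]
    calc ‖y + s • e - x‖ = ‖(y - x) + s • e‖ := by congr 1; abel
      _ ≤ ‖y - x‖ + s * ‖e‖ := by
        refine (norm_add_le _ _).trans ?_
        rw [norm_smul, Real.norm_of_nonneg hs.le]
      _ < r := by rw [he]; linarith
  -- The sweep of `S` in the direction `e`. Starting at height `r / 8 > 0` makes `A` a compact
  -- subset of `Ω`.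
  set A := (fun p : EuclideanSpace ℝ (Fin (n + 1)) × ℝ => p.1 + p.2 • e) ''
    (S ×ˢ Icc (r / 8) (r / 4)) with hA
  have hAcpt : IsCompact A := (hScpt.prod isCompact_Icc).image (by fun_prop)
  have hAΩ : A ⊆ Ω := by
    rintro _ ⟨⟨y, s⟩, ⟨hy, hs⟩, rfl⟩
    exact hmem y hy s (by have := hs.1; dsimp at this; linarith) hs.2
  have hAvol : volume A ≠ 0 := by
    intro h0
    refine hSpos (hausdorffMeasure_eq_zero_of_volume_eq_zero he hγ (fun y hy => ?_)
      (show r / 8 < r / 4 by linarith) (A := A)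
      (fun y hy s hs => ⟨(y, s), ⟨hy, hs⟩, rfl⟩) h0)
    exact hγ.eq_inner_of_mem_frontier_epigraph hΩ hch (hSDf hy.1) (hSball hy)
  have hctrl : IsGradientControlled volume Ω SD A := by
    refine ⟨(r / 4).toNNReal, fun ψ h1 h2 => ?_⟩
    have hG : Measurable (Ω.indicator fun x => ‖fderiv ℝ ψ x‖ₑ) :=
      (h1.continuous_fderiv one_ne_zero).measurable.enorm.indicator hΩ.measurableSet
    calc ∫⁻ z in A, ‖ψ z‖ₑ
        ≤ ∫⁻ z in A, (∫⁻ s in Ioo 0 (r / 4),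
            Ω.indicator (fun x => ‖fderiv ℝ ψ x‖ₑ) (z + 0 + s • -e)) := by
          refine setLIntegral_mono' hAcpt.measurableSet ?_
          rintro _ ⟨⟨y, σ⟩, ⟨hy, hσ⟩, rfl⟩
          have hσ0 : 0 ≤ σ := by have := hσ.1; dsimp at this; linarith
          -- The path descends from `y + σ • e` to `y ∈ SD`, where `ψ` vanishes, so only the
          -- gradient term survives.
          have h3 := enorm_le_enorm_add_lintegral_fderiv h1 (y + σ • e) (-e) hσ0
          have he1 : ‖e‖ₑ = 1 := by rw [← ofReal_norm, he]; simp
          rw [smul_neg, add_neg_cancel_right, h2 y hy.1, enorm_zero, zero_add, enorm_neg, he1,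
            one_mul] at h3
          refine h3.trans ?_
          refine (setLIntegral_mono' measurableSet_Ioo fun s hs => ?_).trans
            (lintegral_mono_set (Ioo_subset_Ioo_right hσ.2))
          dsimp only
          rw [add_zero, indicator_of_mem]
          have h4 : y + σ • e + s • -e = y + (σ - s) • e := by module
          rw [h4]
          exact hmem y hy _ (by linarith [hs.2]) (by have := hσ.2; dsimp at this; linarith [hs.1])
      _ ≤ ∫⁻ z, (∫⁻ s in Ioo 0 (r / 4),
            Ω.indicator (fun x => ‖fderiv ℝ ψ x‖ₑ) (z + 0 + s • -e)) :=
          setLIntegral_le_lintegral _ _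
      _ = _ := by
          rw [lintegral_lintegral_translate volume hG, lintegral_indicator hΩ.measurableSet]
          rfl
  refine hctrl.domain hΩ h.domain.isConnected.isPreconnected h.domain.isBounded (fun y hy => ?_)
    hAcpt.measurableSet hAΩ hAvol
  obtain ⟨ρ, hρ, b, hb⟩ := h.domain.exists_basis_isInwardDirection (frontier_subset_closure hy)
  exact ⟨ρ, hρ, b 0, hb 0⟩

end Poincare

/-! ### Gagliardo's inequality, locally and then on the mixed domain. -/

section Sobolev

open Set Metric Function

/-- The Gagliardo inequality for a function dominated by the line integrals of `G` in the
directions of a basis. -/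
theorem exists_lintegral_rpow_le_of_le_lintegral_line {ι E : Type*} [Fintype ι]
    [NormedAddCommGroup E] [NormedSpace ℝ E] [MeasurableSpace E] [BorelSpace E]
    [FiniteDimensional ℝ E] (μ : Measure E) [μ.IsAddHaarMeasure] (b : Module.Basis ι ℝ E) {p : ℝ}
    (hp : Real.HolderConjugate (Fintype.card ι) p) :
    ∃ C : ℝ≥0, ∀ f G : E → ℝ≥0∞, Measurable f → Measurable G →
      (∀ x i, f x ≤ ∫⁻ s : ℝ, G (x + s • b i)) →
      ∫⁻ x, f x ^ p ∂μ ≤ C * (∫⁻ x, G x ∂μ) ^ p := by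
  classical
  have h0p : 0 ≤ p := hp.symm.nonneg
  let e : (ι → ℝ) ≃L[ℝ] E := b.equivFun.symm.toContinuousLinearEquiv
  have he : ∀ y, e y = ∑ i, y i • b i := fun y => b.equivFun_symm_apply y
  have hν : (Measure.map e volume).IsAddHaarMeasure := e.isAddHaarMeasure_map volume
  let c := Measure.addHaarScalarFactor μ (Measure.map e volume)
  have hc : 0 < c := Measure.addHaarScalarFactor_pos_of_isAddHaarMeasure ..
  have h2c : μ = c • Measure.map e volume := Measure.isAddLeftInvariant_eq_smul ..
  have hint : ∀ f : E → ℝ≥0∞, Measurable f → ∫⁻ x, f x ∂μ = c * ∫⁻ y, f (e y) := by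
    intro f hf
    rw [h2c, ENNReal.smul_def, lintegral_smul_measure, smul_eq_mul,
      lintegral_map hf e.continuous.measurable]
  -- In the basis coordinates `μ` is `c` times Lebesgue measure: the left side scales by `c`, the
  -- right side by `c ^ p`.
  refine ⟨c * (c ^ p)⁻¹, fun f G hf hG h => ?_⟩
  rw [hint _ (hf.pow_const p), hint _ hG, ENNReal.mul_rpow_of_nonneg _ _ h0p, ENNReal.coe_mul,
    mul_assoc, ← ENNReal.coe_rpow_of_nonneg _ h0p, ← mul_assoc ((((c ^ p)⁻¹ : ℝ≥0)) : ℝ≥0∞),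
    ← ENNReal.coe_mul, inv_mul_cancel₀ (NNReal.rpow_pos hc).ne', ENNReal.coe_one, one_mul]
  gcongr
  have hcard : (1 : ℝ) < Fintype.card ι := hp.lt
  calc ∫⁻ y, f (e y) ^ p
      = ∫⁻ y, ∏ _i : ι, f (e y) ^ (1 / (Fintype.card ι - 1 : ℝ)) := by
        congr! 2 with y
        rw [Finset.prod_const, Finset.card_univ, ← ENNReal.rpow_natCast, ← ENNReal.rpow_mul,
          hp.conjugate_eq]
        congr 1
        field_simp
    _ ≤ ∫⁻ y, ∏ i, (∫⁻ t, G (e (update y i t))) ^ (1 / (Fintype.card ι - 1 : ℝ)) := by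
        have h1 : 0 ≤ 1 / (Fintype.card ι - 1 : ℝ) :=
          one_div_nonneg.2 (by linarith)
        gcongr with y i
        refine (h (e y) i).trans (le_of_eq ?_)
        rw [← lintegral_add_left_eq_self (fun t => G (e (update y i t))) (y i)]
        refine lintegral_congr fun s => congrArg G ?_
        have h2 : update y i (y i + s) = y + s • Pi.single i (1 : ℝ) := by
          ext j
          by_cases hj : j = i
          · subst hj; simp
          · simp [hj]
        rw [h2, map_add, map_smul, he (Pi.single i 1)]
        simp [Pi.single_apply]
    _ ≤ (∫⁻ y, G (e y)) ^ p :=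
        lintegral_prod_lintegral_pow_le (fun _ => volume) hp (hG.comp e.continuous.measurable)

/-- The Gagliardo inequality, localized near a point admitting a basis of inward directions. -/
theorem exists_setLIntegral_ball_rpow_le {ι E : Type*} [Fintype ι]
    [NormedAddCommGroup E] [InnerProductSpace ℝ E] [MeasurableSpace E] [BorelSpace E]
    [FiniteDimensional ℝ E] (μ : Measure E) [μ.IsAddHaarMeasure] (b : Module.Basis ι ℝ E) {p : ℝ}
    (hp : Real.HolderConjugate (Fintype.card ι) p) {Ω : Set E} (hΩ : MeasurableSet Ω) {x : E}
    {r : ℝ} (hr : 0 < r) (hb : ∀ i, IsInwardDirection Ω x r (b i)) :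
    ∃ C : ℝ≥0, ∀ ψ : E → ℝ, ContDiff ℝ 1 ψ → ∫⁻ z in ball x (r / 4) ∩ Ω, ‖ψ z‖ₑ ^ p ∂μ ≤
      C * (∫⁻ z in Ω, ‖fderiv ℝ ψ z‖ₑ ∂μ + C * ∫⁻ z in Ω, ‖ψ z‖ₑ ∂μ) ^ p := by
  obtain ⟨C, hC⟩ := exists_lintegral_rpow_le_of_le_lintegral_line μ b hp
  have h0p : 0 < p := hp.symm.pos
  let η : ContDiffBump x := ⟨r / 4, r / 2, by positivity, by linarith⟩
  have hη1 : ContDiff ℝ 1 (η : E → ℝ) := η.contDiff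
  obtain ⟨B, hB⟩ := (hη1.continuous_fderiv one_ne_zero).bounded_above_of_compact_support
    (η.hasCompactSupport.fderiv (𝕜 := ℝ))
  have hB0 : 0 ≤ B := (norm_nonneg _).trans (hB x)
  set M : ℝ≥0 := ∑ i, ‖b i‖₊ with hM
  -- The statement uses one constant in two places; the maximum serves both.
  refine ⟨max (C * M ^ p) B.toNNReal, fun ψ hψ => ?_⟩
  set u : E → ℝ := fun z => η z * ψ z with hu
  have hu1 : ContDiff ℝ 1 u := hη1.mul hψ
  have hDu : Measurable fun z => ‖fderiv ℝ u z‖ₑ :=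
    (hu1.continuous_fderiv one_ne_zero).measurable.enorm
  have hDψ : Measurable fun z => ‖fderiv ℝ ψ z‖ₑ :=
    (hψ.continuous_fderiv one_ne_zero).measurable.enorm
  have htu : tsupport u ⊆ closedBall x (r / 2) := by
    refine (tsupport_mul_subset_left (f := (η : E → ℝ)) (g := ψ)).trans ?_
    rw [η.tsupport_eq]
  have hu0 : ∀ z ∉ ball x r, u z = 0 := fun z hz =>
    image_eq_zero_of_notMem_tsupport fun h =>
      hz (closedBall_subset_ball (show r / 2 < r by linarith) (htu h))
  have hDu0 : ∀ z ∉ ball x r, fderiv ℝ u z = 0 := fun z hz =>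
    image_eq_zero_of_notMem_tsupport fun h => hz
      (closedBall_subset_ball (show r / 2 < r by linarith) (htu (tsupport_fderiv_subset ℝ h)))
  have hbound : ∀ z, ‖fderiv ℝ u z‖ₑ ≤ ‖fderiv ℝ ψ z‖ₑ + B.toNNReal * ‖ψ z‖ₑ := by
    intro z
    rw [hu, fderiv_fun_mul (hη1.differentiable one_ne_zero z) (hψ.differentiable one_ne_zero z)]
    refine (enorm_add_le (_ : E →L[ℝ] ℝ) _).trans ?_
    rw [enorm_smul, enorm_smul, mul_comm ‖ψ z‖ₑ]
    refine add_le_add (mul_le_of_le_one_left zero_le ?_) ?_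
    · rw [← ofReal_norm, Real.norm_of_nonneg η.nonneg]
      exact ENNReal.ofReal_le_one.2 η.le_one
    · gcongr
      rw [← ofReal_norm]
      exact ENNReal.ofReal_le_ofReal (hB z)
  have hline : ∀ z i, Ω.indicator (fun z => ‖u z‖ₑ) z ≤
      ∫⁻ s : ℝ, M * Ω.indicator (fun z => ‖fderiv ℝ u z‖ₑ) (z + s • b i) := by
    intro z i
    by_cases hz : z ∈ Ω
    swap
    · simp [hz]
    by_cases hzr : z ∈ ball x r
    swap
    · simp [hz, hu0 z hzr]
    rw [indicator_of_mem hz]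
    have hbi : 0 < ‖b i‖ := norm_pos_iff.2 (b.ne_zero i)
    -- Long enough for the segment from `z` to leave `ball x r`, where the cut-off function `u`
    -- vanishes.
    set T := 2 * r / ‖b i‖ with hT
    have hT0 : 0 ≤ T := by positivity
    have hzT : z + T • b i ∉ ball x r := by
      rw [mem_ball, dist_eq_norm] at hzr ⊢
      rw [not_lt]
      have h1 : ‖T • b i‖ = 2 * r := by
        rw [norm_smul, Real.norm_of_nonneg hT0, hT]; field_simp
      have h2 : ‖T • b i‖ ≤ ‖z + T • b i - x‖ + ‖z - x‖ := by
        calc ‖T • b i‖ = ‖(z + T • b i - x) - (z - x)‖ := by congr 1; abel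
          _ ≤ _ := norm_sub_le _ _
      linarith
    have h3 := enorm_le_enorm_add_lintegral_fderiv hu1 z (b i) hT0
    rw [hu0 _ hzT, enorm_zero, zero_add] at h3
    refine h3.trans ?_
    rw [lintegral_const_mul' _ _ ENNReal.coe_ne_top]
    refine mul_le_mul' ?_ ?_
    · rw [enorm_eq_nnnorm, ENNReal.coe_le_coe]
      exact Finset.single_le_sum (f := fun i => ‖b i‖₊) (fun _ _ => zero_le) (Finset.mem_univ i)
    · refine (setLIntegral_mono' measurableSet_Ioo fun s hs => ?_).trans
        (setLIntegral_le_lintegral (Ioo 0 T) _)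
      -- Inside the ball the point lies in `Ω` by inwardness; outside it the derivative of `u` is
      -- zero.
      by_cases hzs : z + s • b i ∈ ball x r
      · rw [indicator_of_mem (hb i z (subset_closure hz) hzr s hs.1 hzs)]
      · rw [← ofReal_norm, hDu0 _ hzs, norm_zero, ENNReal.ofReal_zero]; exact zero_le
  have hmain := hC _ _ (hu1.continuous.measurable.enorm.indicator hΩ)
    (measurable_const.mul (hDu.indicator hΩ)) hline
  calc ∫⁻ z in ball x (r / 4) ∩ Ω, ‖ψ z‖ₑ ^ p ∂μ
      ≤ ∫⁻ z, (Ω.indicator (fun z => ‖u z‖ₑ) z) ^ p ∂μ := by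
        rw [← lintegral_indicator (measurableSet_ball.inter hΩ)]
        refine lintegral_mono fun z => ?_
        by_cases hz : z ∈ ball x (r / 4) ∩ Ω
        · rw [indicator_of_mem hz, indicator_of_mem hz.2, hu]
          simp only
          rw [η.one_of_mem_closedBall (ball_subset_closedBall hz.1), one_mul]
        · rw [indicator_of_notMem hz]; exact zero_le
    _ ≤ C * (∫⁻ z, M * Ω.indicator (fun z => ‖fderiv ℝ u z‖ₑ) z ∂μ) ^ p := hmain
    _ = (C * M ^ p : ℝ≥0) * (∫⁻ z in Ω, ‖fderiv ℝ u z‖ₑ ∂μ) ^ p := by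
        rw [lintegral_const_mul _ (hDu.indicator hΩ), lintegral_indicator hΩ,
          ENNReal.mul_rpow_of_nonneg _ _ h0p.le, ENNReal.coe_mul,
          ENNReal.coe_rpow_of_nonneg _ h0p.le, mul_assoc]
    _ ≤ (C * M ^ p : ℝ≥0) * (∫⁻ z in Ω, ‖fderiv ℝ ψ z‖ₑ ∂μ +
          B.toNNReal * ∫⁻ z in Ω, ‖ψ z‖ₑ ∂μ) ^ p := by
        gcongr
        rw [← lintegral_const_mul' _ _ ENNReal.coe_ne_top, ← lintegral_add_left hDψ]
        exact lintegral_mono fun z => hbound z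
    _ ≤ _ := by
        gcongr
        · exact le_max_left _ _
        · exact le_max_right _ _

/-- The `W^{1,1}` Sobolev inequality for functions vanishing on the Dirichlet part of the
boundary. -/
theorem IsMixedDomain.exists_lintegral_rpow_le {n : ℕ}
    {Ω SD SN : Set (EuclideanSpace ℝ (Fin (n + 1)))} (h : IsMixedDomain Ω SD SN) {p : ℝ}
    (hp : Real.HolderConjugate ((n + 1 : ℕ) : ℝ) p) :
    ∃ C : ℝ≥0, ∀ ψ : EuclideanSpace ℝ (Fin (n + 1)) → ℝ, ContDiff ℝ 1 ψ → (∀ x ∈ SD, ψ x = 0) →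
      ∫⁻ x in Ω, ‖ψ x‖ₑ ^ p ≤ C * (∫⁻ x in Ω, ‖fderiv ℝ ψ x‖ₑ) ^ p := by
  obtain ⟨B, hB⟩ := h.isGradientControlled
  have h0p : 0 < p := hp.symm.pos
  have hΩ := h.domain.isOpen.measurableSet
  have key : ∃ C : ℝ≥0, ∀ ψ : EuclideanSpace ℝ (Fin (n + 1)) → ℝ, ContDiff ℝ 1 ψ →
      (∀ x ∈ SD, ψ x = 0) →
      ∫⁻ x in closure Ω ∩ Ω, ‖ψ x‖ₑ ^ p ≤ C * (∫⁻ x in Ω, ‖fderiv ℝ ψ x‖ₑ) ^ p := by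
    refine h.domain.isBounded.isCompact_closure.induction_on
      (p := fun t => ∃ C : ℝ≥0, ∀ ψ : EuclideanSpace ℝ (Fin (n + 1)) → ℝ, ContDiff ℝ 1 ψ →
        (∀ x ∈ SD, ψ x = 0) →
        ∫⁻ x in t ∩ Ω, ‖ψ x‖ₑ ^ p ≤ C * (∫⁻ x in Ω, ‖fderiv ℝ ψ x‖ₑ) ^ p) ?_ ?_ ?_ ?_
    · exact ⟨0, fun ψ _ _ => by simp⟩
    · rintro s t hst ⟨C, hC⟩
      exact ⟨C, fun ψ h1 h2 => (lintegral_mono_set (inter_subset_inter_left _ hst)).trans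
        (hC ψ h1 h2)⟩
    · rintro s t ⟨C, hC⟩ ⟨C', hC'⟩
      refine ⟨C + C', fun ψ h1 h2 => ?_⟩
      rw [union_inter_distrib_right, ENNReal.coe_add, add_mul]
      exact (lintegral_union_le _ _ _).trans (add_le_add (hC ψ h1 h2) (hC' ψ h1 h2))
    · intro x hx
      obtain ⟨r, hr, b, hb⟩ := h.domain.exists_basis_isInwardDirection hx
      obtain ⟨C, hC⟩ := exists_setLIntegral_ball_rpow_le volume b (by simpa using hp) hΩ hr hb
      refine ⟨_, mem_nhdsWithin_of_mem_nhds (ball_mem_nhds x (show 0 < r / 4 by positivity)),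
        -- The Poincaré constant `B` absorbs the `L¹` term of the local inequality.
        C * (1 + C * B) ^ p, fun ψ h1 h2 => (hC ψ h1).trans ?_⟩
      rw [ENNReal.coe_mul, ENNReal.coe_rpow_of_nonneg _ h0p.le, mul_assoc,
        ← ENNReal.mul_rpow_of_nonneg _ _ h0p.le]
      gcongr
      rw [ENNReal.coe_add, add_mul, ENNReal.coe_one, one_mul, ENNReal.coe_mul, mul_assoc]
      gcongr
      exact hB ψ h1 h2
  obtain ⟨C, hC⟩ := key
  refine ⟨C, fun ψ h1 h2 => ?_⟩
  have := hC ψ h1 h2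
  rwa [inter_eq_right.2 subset_closure] at this

end Sobolev

/-! ### Gradients of smooth functions: chain rule and integration by parts. -/

section Gradient

open Filter Topology

variable {E : Type*} [NormedAddCommGroup E] [InnerProductSpace ℝ E] [CompleteSpace E]

theorem norm_gradient_eq_norm_fderiv (f : E → ℝ) (x : E) : ‖∇ f x‖ = ‖fderiv ℝ f x‖ :=
  LinearIsometryEquiv.norm_map _ _

theorem enorm_gradient_eq_enorm_fderiv (f : E → ℝ) (x : E) : ‖∇ f x‖ₑ = ‖fderiv ℝ f x‖ₑ := by
  rw [← ofReal_norm, ← ofReal_norm, norm_gradient_eq_norm_fderiv]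

theorem ContDiff.continuous_gradient {f : E → ℝ} (hf : ContDiff ℝ 1 f) : Continuous (∇ f) :=
  (LinearIsometryEquiv.continuous _).comp (hf.continuous_fderiv one_ne_zero)

theorem HasCompactSupport.gradient {f : E → ℝ} (hf : HasCompactSupport f) :
    HasCompactSupport (∇ f) :=
  (hf.fderiv (𝕜 := ℝ)).comp_left (g := (InnerProductSpace.toDual ℝ E).symm) (map_zero _)

theorem gradient_comp_eq_deriv_smul {F : ℝ → ℝ} {f : E → ℝ} {x : E}
    (hF : DifferentiableAt ℝ F (f x)) (hf : DifferentiableAt ℝ f x) :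
    ∇ (fun y => F (f y)) x = deriv F (f x) • ∇ f x := by
  have h : HasFDerivAt (fun y => F (f y)) (deriv F (f x) • fderiv ℝ f x) x :=
    hF.hasDerivAt.comp_hasFDerivAt x hf.hasFDerivAt
  rw [_root_.gradient, h.fderiv, map_smulₛₗ]
  rfl

variable [MeasurableSpace E] [BorelSpace E] [FiniteDimensional ℝ E] (μ : Measure E)
  [μ.IsAddHaarMeasure]

/-- Integration by parts for gradients. -/
theorem integral_smul_gradient_eq_neg {f g : E → ℝ} (hf : ContDiff ℝ 1 f) (hg : ContDiff ℝ 1 g)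
    (hfc : HasCompactSupport f) :
    ∫ x, f x • ∇ g x ∂μ = - ∫ x, g x • ∇ f x ∂μ := by
  have h1 : Integrable (fun x => f x • ∇ g x) μ :=
    (hf.continuous.smul hg.continuous_gradient).integrable_of_hasCompactSupport hfc.smul_right
  have h2 : Integrable (fun x => g x • ∇ f x) μ :=
    (hg.continuous.smul hf.continuous_gradient).integrable_of_hasCompactSupport
      hfc.gradient.smul_left
  have hin : ∀ (k : E → ℝ) (x v : E), inner ℝ v (∇ k x) = fderiv ℝ k x v := by
    intro k x v
    rw [real_inner_comm]
    exact InnerProductSpace.toDual_symm_apply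
  refine ext_inner_left ℝ fun v => ?_
  rw [inner_neg_right, ← integral_inner h1, ← integral_inner h2]
  simp_rw [real_inner_smul_right, hin]
  rw [integral_mul_fderiv_eq_neg_fderiv_mul_of_integrable]
  · simp_rw [mul_comm]
  · refine (((hf.continuous_fderiv one_ne_zero).clm_apply continuous_const).mul
      hg.continuous).integrable_of_hasCompactSupport ?_
    exact (hfc.fderiv_apply (𝕜 := ℝ) v).mul_right
  · exact (hf.continuous.mul ((hg.continuous_fderiv one_ne_zero).clm_apply
      continuous_const)).integrable_of_hasCompactSupport hfc.mul_right
  · exact (hf.continuous.mul hg.continuous).integrable_of_hasCompactSupport hfc.mul_right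
  · exact fun x _ => hf.differentiable one_ne_zero x
  · exact fun x _ => hg.differentiable one_ne_zero x

end Gradient

/-! ### Approximation and chain rule in the mixed Sobolev space. -/

section Mixed

open Filter Topology

variable {N : ℕ} {Ω SD : Set (EuclideanSpace ℝ (Fin N))} {u : EuclideanSpace ℝ (Fin N) → ℝ}
  {G : EuclideanSpace ℝ (Fin N) → EuclideanSpace ℝ (Fin N)}

theorem tendsto_integral_smul_of_tendsto_eLpNorm_two {α F : Type*} [MeasurableSpace α]
    [NormedAddCommGroup F] [NormedSpace ℝ F] {μ : Measure α} {f : ℕ → α → ℝ} {f' : α → ℝ}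
    {g : ℕ → α → F} {g' : α → F} (hf : ∀ n, MemLp (f n) 2 μ) (hf' : MemLp f' 2 μ)
    (hg : ∀ n, MemLp (g n) 2 μ) (hg' : MemLp g' 2 μ)
    (hft : Tendsto (fun n => eLpNorm (fun x => f' x - f n x) 2 μ) atTop (𝓝 0))
    (hgt : Tendsto (fun n => eLpNorm (fun x => g' x - g n x) 2 μ) atTop (𝓝 0)) :
    Tendsto (fun n => ∫ x, f n x • g n x ∂μ) atTop (𝓝 (∫ x, f' x • g' x ∂μ)) := by
  refine tendsto_integral_of_L1' _ (memLp_one_iff_integrable.1 (hg'.smul hf')).1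
    (Eventually.of_forall fun n => memLp_one_iff_integrable.1 ((hg n).smul (hf n))) ?_
  have hd : ∀ n, eLpNorm ((fun x => f n x • g n x) - fun x => f' x • g' x) 1 μ ≤
      eLpNorm (fun x => f' x - f n x) 2 μ * (eLpNorm g' 2 μ +
        eLpNorm (fun x => g' x - g n x) 2 μ) +
      eLpNorm f' 2 μ * eLpNorm (fun x => g' x - g n x) 2 μ := by
    intro n
    have h1 : AEStronglyMeasurable (fun x => f' x - f n x) μ := (hf'.1.sub (hf n).1)
    have h2 : AEStronglyMeasurable (fun x => g' x - g n x) μ := (hg'.1.sub (hg n).1)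
    have h3 : eLpNorm (g n) 2 μ ≤ eLpNorm g' 2 μ + eLpNorm (fun x => g' x - g n x) 2 μ := by
      have : g n = g' - fun x => g' x - g n x := by funext x; simp
      conv_lhs => rw [this]
      exact eLpNorm_sub_le hg'.1 h2 (by norm_num)
    have h4 : ((fun x => f n x • g n x) - fun x => f' x • g' x) =
        -(((fun x => f' x - f n x) • g n) + f' • fun x => g' x - g n x) := by
      funext x
      simp only [Pi.sub_apply, Pi.neg_apply, Pi.add_apply, Pi.smul_apply']
      module
    rw [h4, eLpNorm_neg]
    refine (eLpNorm_add_le (h1.smul (hg n).1) (hf'.1.smul h2) le_rfl).trans ?_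
    refine add_le_add ((eLpNorm_smul_le_mul_eLpNorm (p := 2) (q := 2) (hg n).1 h1).trans ?_)
      (eLpNorm_smul_le_mul_eLpNorm h2 hf'.1)
    gcongr
  refine tendsto_of_tendsto_of_tendsto_of_le_of_le tendsto_const_nhds ?_ (fun _ => zero_le) hd
  have hg2 : eLpNorm g' 2 μ ≠ ⊤ := hg'.2.ne
  have hf2 : eLpNorm f' 2 μ ≠ ⊤ := hf'.2.ne
  have h5 : Tendsto (fun n => eLpNorm g' 2 μ + eLpNorm (fun x => g' x - g n x) 2 μ) atTop
      (𝓝 (eLpNorm g' 2 μ + 0)) := tendsto_const_nhds.add hgt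
  have h6 := ENNReal.Tendsto.mul hft (Or.inr (by simpa using hg2)) h5 (Or.inr (by simp))
  have h7 := ENNReal.Tendsto.const_mul (a := eLpNorm f' 2 μ) hgt (Or.inr hf2)
  simpa using h6.add h7

/-- A function in the closure of `C_c^∞(Ω ∪ SN)` is the limit, almost everywhere and in `H¹`, of a
sequence of such functions. -/
theorem exists_seq_tendsto_of_approx (hu : AEStronglyMeasurable u (volume.restrict Ω))
    (approx : ∀ ε : ℝ≥0∞, 0 < ε → ∃ ψ : EuclideanSpace ℝ (Fin N) → ℝ,
      ContDiff ℝ ∞ ψ ∧ HasCompactSupport ψ ∧ Disjoint (tsupport ψ) SD ∧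
        eLpNorm (fun x => u x - ψ x) 2 (volume.restrict Ω) < ε ∧
        eLpNorm (fun x => G x - ∇ ψ x) 2 (volume.restrict Ω) < ε) :
    ∃ ψ : ℕ → EuclideanSpace ℝ (Fin N) → ℝ,
      (∀ n, ContDiff ℝ ∞ (ψ n) ∧ HasCompactSupport (ψ n) ∧ Disjoint (tsupport (ψ n)) SD) ∧
      Tendsto (fun n => eLpNorm (fun x => u x - ψ n x) 2 (volume.restrict Ω)) atTop (𝓝 0) ∧
      Tendsto (fun n => eLpNorm (fun x => G x - ∇ (ψ n) x) 2 (volume.restrict Ω)) atTop (𝓝 0) ∧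
      ∀ᵐ x ∂(volume.restrict Ω), Tendsto (fun n => ψ n x) atTop (𝓝 (u x)) := by
  have h : ∀ n : ℕ, (0 : ℝ≥0∞) < (n : ℝ≥0∞)⁻¹ := fun n =>
    ENNReal.inv_pos.2 (ENNReal.natCast_ne_top n)
  choose ψ h1 h2 h3 h4 h5 using fun n : ℕ => approx _ (h n)
  have hz := ENNReal.tendsto_inv_nat_nhds_zero
  have t4 := tendsto_of_tendsto_of_tendsto_of_le_of_le tendsto_const_nhds hz
    (fun _ => zero_le) (fun n => (h4 n).le)
  have t5 := tendsto_of_tendsto_of_tendsto_of_le_of_le tendsto_const_nhds hz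
    (fun _ => zero_le) (fun n => (h5 n).le)
  have hm : TendstoInMeasure (volume.restrict Ω) ψ atTop u := by
    refine tendstoInMeasure_of_tendsto_eLpNorm (p := 2) (by norm_num)
      (fun n => (h1 n).continuous.aestronglyMeasurable) hu ?_
    refine t4.congr fun n => ?_
    exact eLpNorm_sub_comm u (ψ n) 2 _
  obtain ⟨ns, hns, hae⟩ := hm.exists_seq_tendsto_ae
  exact ⟨fun n => ψ (ns n), fun n => ⟨h1 _, h2 _, h3 _⟩, t4.comp hns.tendsto_atTop,
    t5.comp hns.tendsto_atTop, hae⟩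

/-- The weak gradient identity holds for the smooth approximants by integration by parts and
survives `L²` limits, so only the approximation property needs checking. -/
theorem MemH1Mixed.of_approx (hu : MemLp u 2 (volume.restrict Ω))
    (hG : MemLp G 2 (volume.restrict Ω))
    (approx : ∀ ε : ℝ≥0∞, 0 < ε → ∃ ψ : EuclideanSpace ℝ (Fin N) → ℝ,
      ContDiff ℝ ∞ ψ ∧ HasCompactSupport ψ ∧ Disjoint (tsupport ψ) SD ∧
        eLpNorm (fun x => u x - ψ x) 2 (volume.restrict Ω) < ε ∧
        eLpNorm (fun x => G x - ∇ ψ x) 2 (volume.restrict Ω) < ε) : MemH1Mixed Ω SD u G := by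
  refine ⟨⟨hu, hG, fun η hη hηc hηΩ => ?_⟩, approx⟩
  obtain ⟨ψ, hψ, t1, t2, -⟩ := exists_seq_tendsto_of_approx hu.1 approx
  have hη1 : ContDiff ℝ 1 η := hη.of_le (by exact_mod_cast le_top)
  have hψ1 : ∀ n, ContDiff ℝ 1 (ψ n) := fun n => (hψ n).1.of_le (by exact_mod_cast le_top)
  have m1 : MemLp η 2 (volume.restrict Ω) :=
    (hη1.continuous.memLp_of_hasCompactSupport hηc).restrict Ω
  have m2 : MemLp (∇ η) 2 (volume.restrict Ω) :=
    (hη1.continuous_gradient.memLp_of_hasCompactSupport hηc.gradient).restrict Ω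
  have m3 : ∀ n, MemLp (ψ n) 2 (volume.restrict Ω) := fun n =>
    ((hψ1 n).continuous.memLp_of_hasCompactSupport (hψ n).2.1).restrict Ω
  have m4 : ∀ n, MemLp (∇ (ψ n)) 2 (volume.restrict Ω) := fun n =>
    ((hψ1 n).continuous_gradient.memLp_of_hasCompactSupport (hψ n).2.1.gradient).restrict Ω
  have l1 := tendsto_integral_smul_of_tendsto_eLpNorm_two m3 hu (fun _ => m2) m2 t1 (by simp)
  have l2 := tendsto_integral_smul_of_tendsto_eLpNorm_two (fun _ => m1) m1 m4 hG (by simp) t2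
  refine tendsto_nhds_unique l1 (l2.neg.congr fun n => ?_)
  have hη0 : ∀ x ∉ Ω, η x = 0 := fun x hx => image_eq_zero_of_notMem_tsupport fun h => hx (hηΩ h)
  have hη0' : ∀ x ∉ Ω, ∇ η x = 0 := fun x hx => by
    rw [← norm_eq_zero, norm_gradient_eq_norm_fderiv, norm_eq_zero]
    exact image_eq_zero_of_notMem_tsupport fun h => hx (hηΩ (tsupport_fderiv_subset ℝ h))
  rw [setIntegral_eq_integral_of_forall_compl_eq_zero fun x hx => by rw [hη0 x hx, zero_smul],
    setIntegral_eq_integral_of_forall_compl_eq_zero fun x hx => by rw [hη0' x hx, smul_zero],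
    integral_smul_gradient_eq_neg volume hη1 (hψ1 n) hηc, neg_neg]

/-- Chain rule in `H¹_{SD}(Ω)`. -/
theorem MemH1Mixed.comp (h : MemH1Mixed Ω SD u G) {F : ℝ → ℝ}
    (hF : ContDiff ℝ ∞ F) (hF0 : F 0 = 0) {M : ℝ≥0} (hM : ∀ t, ‖deriv F t‖ ≤ M) :
    MemH1Mixed Ω SD (fun x => F (u x)) (fun x => deriv F (u x) • G x) := by
  have hF1 : ContDiff ℝ 1 F := hF.of_le (by exact_mod_cast le_top)
  have hFd : Differentiable ℝ F := hF1.differentiable one_ne_zero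
  have hF' : Continuous (deriv F) := hF1.continuous_deriv le_rfl
  have hlip : LipschitzWith M F := lipschitzWith_of_nnnorm_deriv_le hFd fun t => hM t
  have hu := h.memH1.memLp
  have hG := h.memH1.memLp_grad
  obtain ⟨ψ, hψ, t1, t2, hae⟩ := exists_seq_tendsto_of_approx hu.1 h.approx
  have hψ1 : ∀ n, ContDiff ℝ 1 (ψ n) := fun n => (hψ n).1.of_le (by exact_mod_cast le_top)
  have hFu : AEStronglyMeasurable (fun x => deriv F (u x)) (volume.restrict Ω) :=
    hF'.comp_aestronglyMeasurable hu.1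
  have hFψ : ∀ n, AEStronglyMeasurable (fun x => deriv F (ψ n x)) (volume.restrict Ω) := fun n =>
    (hF'.comp (hψ1 n).continuous).aestronglyMeasurable
  refine MemH1Mixed.of_approx ?_ ?_ ?_
  · refine (hu.norm.const_mul (M : ℝ)).mono' (hF1.continuous.comp_aestronglyMeasurable hu.1)
      (Eventually.of_forall fun x => ?_)
    have := hlip.dist_le_mul (u x) 0
    rwa [hF0, dist_zero_right, dist_zero_right] at this
  · refine (hG.norm.const_mul (M : ℝ)).mono' (hFu.smul hG.1) (Eventually.of_forall fun x => ?_)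
    rw [norm_smul]
    exact mul_le_mul_of_nonneg_right (hM _) (norm_nonneg _)
  · have s1 : Tendsto (fun n => eLpNorm (fun x => F (u x) - F (ψ n x)) 2 (volume.restrict Ω)) atTop
        (𝓝 0) := by
      have := ENNReal.Tendsto.const_mul (a := (M : ℝ≥0∞)) t1 (Or.inr ENNReal.coe_ne_top)
      rw [mul_zero] at this
      refine tendsto_of_tendsto_of_tendsto_of_le_of_le tendsto_const_nhds this (fun _ => zero_le)
        fun n => ?_
      refine eLpNorm_le_nnreal_smul_eLpNorm_of_ae_le_mul (Eventually.of_forall fun x => ?_) _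
      have := hlip.dist_le_mul (u x) (ψ n x)
      rwa [dist_eq_norm, dist_eq_norm] at this
    -- No Lipschitz bound on `deriv F` is available, so this term is handled by dominated
    -- convergence, using the almost everywhere convergence of `ψ n`.
    have s2 : Tendsto (fun n => eLpNorm (fun x => (deriv F (u x) - deriv F (ψ n x)) • G x) 2
        (volume.restrict Ω)) atTop (𝓝 0) := by
      have hsq : Tendsto (fun n => ∫⁻ x in Ω, ‖(deriv F (u x) - deriv F (ψ n x)) • G x‖ₑ ^ (2 : ℝ))
          atTop (𝓝 (∫⁻ x in Ω, 0)) := by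
        refine tendsto_lintegral_of_dominated_convergence'
          (fun x => ((2 * M : ℝ≥0) * ‖G x‖ₑ) ^ (2 : ℝ))
          (fun n => (((hFu.sub (hFψ n)).smul hG.1).enorm.pow_const _))
          (fun n => Eventually.of_forall fun x => ?_) ?_ ?_
        · dsimp only
          gcongr
          rw [enorm_smul]
          gcongr
          rw [enorm_eq_nnnorm, ENNReal.coe_le_coe, ← NNReal.coe_le_coe]
          push_cast
          refine (norm_sub_le _ _).trans ?_
          linarith [hM (u x), hM (ψ n x)]
        · simp_rw [ENNReal.mul_rpow_of_nonneg _ _ zero_le_two]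
          rw [lintegral_const_mul' _ _ (by finiteness)]
          refine ENNReal.mul_ne_top (by finiteness) ?_
          have := lintegral_rpow_enorm_lt_top_of_eLpNorm_lt_top (p := 2) (by norm_num) (by norm_num)
            hG.2
          simpa using this.ne
        · filter_upwards [hae] with x hx
          have h1 : Tendsto (fun n => ‖(deriv F (u x) - deriv F (ψ n x)) • G x‖ₑ ^ (2 : ℝ)) atTop
              (𝓝 (‖(deriv F (u x) - deriv F (u x)) • G x‖ₑ ^ (2 : ℝ))) := by
            refine ((ENNReal.continuous_rpow_const).tendsto _).comp ?_
            refine (continuous_enorm.tendsto _).comp ?_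
            exact (tendsto_const_nhds.sub ((hF'.tendsto _).comp hx)).smul_const _
          simpa using h1
      have := ((ENNReal.continuous_rpow_const (y := (1 / 2 : ℝ))).tendsto _).comp hsq
      simp only [lintegral_zero] at this
      rw [ENNReal.zero_rpow_of_pos (by norm_num)] at this
      refine this.congr fun n => ?_
      rw [eLpNorm_eq_lintegral_rpow_enorm_toReal (by norm_num) (by norm_num)]
      simp
    have s3 : Tendsto (fun n => eLpNorm (fun x => deriv F (u x) • G x -
        ∇ (fun y => F (ψ n y)) x) 2 (volume.restrict Ω)) atTop (𝓝 0) := by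
      have := (ENNReal.Tendsto.const_mul (a := (M : ℝ≥0∞)) t2 (Or.inr ENNReal.coe_ne_top)).add s2
      rw [mul_zero, zero_add] at this
      refine tendsto_of_tendsto_of_tendsto_of_le_of_le tendsto_const_nhds this (fun _ => zero_le)
        fun n => ?_
      have hgm : AEStronglyMeasurable (fun x => G x - ∇ (ψ n) x) (volume.restrict Ω) :=
        hG.1.sub (hψ1 n).continuous_gradient.aestronglyMeasurable
      have heq : (fun x => deriv F (u x) • G x - ∇ (fun y => F (ψ n y)) x) =
          (fun x => deriv F (ψ n x) • (G x - ∇ (ψ n) x)) +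
            fun x => (deriv F (u x) - deriv F (ψ n x)) • G x := by
        funext x
        rw [gradient_comp_eq_deriv_smul (hFd _) ((hψ1 n).differentiable one_ne_zero x)]
        simp only [Pi.add_apply]
        module
      rw [heq]
      refine (eLpNorm_add_le ((hFψ n).smul hgm) ((hFu.sub (hFψ n)).smul hG.1) (by norm_num)).trans ?_
      refine add_le_add ?_ le_rfl
      refine eLpNorm_le_nnreal_smul_eLpNorm_of_ae_le_mul (Eventually.of_forall fun x => ?_) _
      rw [Pi.smul_apply', nnnorm_smul]
      gcongr
      exact hM _
    intro ε hε
    obtain ⟨n, hn1, hn2⟩ := ((s1.eventually_lt_const hε).and (s3.eventually_lt_const hε)).exists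
    refine ⟨fun y => F (ψ n y), hF.comp (hψ n).1, (hψ n).2.1.comp_left hF0, ?_, hn1, hn2⟩
    refine (hψ n).2.2.mono_left (closure_mono ?_)
    exact Function.support_comp_subset hF0 (ψ n)

end Mixed

/-! ### Gagliardo-Nirenberg inequalities for mixed boundary conditions. -/

section MixedSobolev

open Filter Topology

variable {N : ℕ} {Ω SD : Set (EuclideanSpace ℝ (Fin N))}

/-- The Gagliardo-Nirenberg inequality
`‖u‖_q ≤ K ‖u‖_2^a ‖∇u‖_2^b` for all `u ∈ H¹_{SD}(Ω)`. -/
def MixedGagliardoNirenberg (Ω SD : Set (EuclideanSpace ℝ (Fin N))) (q a b : ℝ) (K : ℝ≥0∞) :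
    Prop :=
  ∀ (u : EuclideanSpace ℝ (Fin N) → ℝ) (G : EuclideanSpace ℝ (Fin N) → EuclideanSpace ℝ (Fin N)),
    MemH1Mixed Ω SD u G → eLpNorm u (ENNReal.ofReal q) (volume.restrict Ω) ≤
      K * (eLpNorm u 2 (volume.restrict Ω) ^ a * eLpNorm G 2 (volume.restrict Ω) ^ b)

/-- A Gagliardo-Nirenberg inequality extends from smooth functions to their closure in `H¹`. -/
theorem MixedGagliardoNirenberg.of_contDiff {q a b : ℝ} {K : ℝ≥0∞} (hK : K ≠ ⊤) (ha : 0 ≤ a)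
    (hb : 0 ≤ b)
    (h : ∀ ψ : EuclideanSpace ℝ (Fin N) → ℝ, ContDiff ℝ 1 ψ → HasCompactSupport ψ →
      (∀ x ∈ SD, ψ x = 0) → eLpNorm ψ (ENNReal.ofReal q) (volume.restrict Ω) ≤
        K * (eLpNorm ψ 2 (volume.restrict Ω) ^ a * eLpNorm (∇ ψ) 2 (volume.restrict Ω) ^ b)) :
    MixedGagliardoNirenberg Ω SD q a b K := by
  intro u G hu
  set μ := volume.restrict Ω with hμ
  have hu2 := hu.memH1.memLp
  have hG2 := hu.memH1.memLp_grad
  obtain ⟨ψ, hψ, t1, t2, hae⟩ := exists_seq_tendsto_of_approx hu2.1 hu.approx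
  have hψ1 : ∀ n, ContDiff ℝ 1 (ψ n) := fun n => (hψ n).1.of_le (by exact_mod_cast le_top)
  have hψm : ∀ n, AEStronglyMeasurable (ψ n) μ := fun n =>
    (hψ1 n).continuous.aestronglyMeasurable
  have hGm : ∀ n, AEStronglyMeasurable (∇ (ψ n)) μ := fun n =>
    (hψ1 n).continuous_gradient.aestronglyMeasurable
  -- Fatou's lemma suffices; convergence in `L^q` is not needed.
  refine (Lp.eLpNorm_lim_le_liminf_eLpNorm hψm u hae).trans ?_
  have hle : ∀ n, eLpNorm (ψ n) (ENNReal.ofReal q) μ ≤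
      K * ((eLpNorm u 2 μ + eLpNorm (fun x => u x - ψ n x) 2 μ) ^ a *
        (eLpNorm G 2 μ + eLpNorm (fun x => G x - ∇ (ψ n) x) 2 μ) ^ b) := by
    intro n
    refine (h (ψ n) (hψ1 n) (hψ n).2.1 fun x hx => image_eq_zero_of_notMem_tsupport fun hx' =>
      Set.disjoint_left.1 (hψ n).2.2 hx' hx).trans ?_
    gcongr
    · have : ψ n = u - fun x => u x - ψ n x := by funext x; simp
      conv_lhs => rw [this]
      exact eLpNorm_sub_le hu2.1 (hu2.1.sub (hψm n)) (by norm_num)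
    · have : ∇ (ψ n) = G - fun x => G x - ∇ (ψ n) x := by funext x; simp
      conv_lhs => rw [this]
      exact eLpNorm_sub_le hG2.1 (hG2.1.sub (hGm n)) (by norm_num)
  have hu' : eLpNorm u 2 μ ≠ ⊤ := hu2.2.ne
  have hG' : eLpNorm G 2 μ ≠ ⊤ := hG2.2.ne
  have l1 : Tendsto (fun n => (eLpNorm u 2 μ + eLpNorm (fun x => u x - ψ n x) 2 μ) ^ a) atTop
      (𝓝 (eLpNorm u 2 μ ^ a)) := by
    have := (ENNReal.continuous_rpow_const (y := a)).tendsto _ |>.comp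
      (tendsto_const_nhds.add t1 : Tendsto _ _ (𝓝 (eLpNorm u 2 μ + 0)))
    simpa [Function.comp_def] using this
  have l2 : Tendsto (fun n => (eLpNorm G 2 μ + eLpNorm (fun x => G x - ∇ (ψ n) x) 2 μ) ^ b) atTop
      (𝓝 (eLpNorm G 2 μ ^ b)) := by
    have := (ENNReal.continuous_rpow_const (y := b)).tendsto _ |>.comp
      (tendsto_const_nhds.add t2 : Tendsto _ _ (𝓝 (eLpNorm G 2 μ + 0)))
    simpa [Function.comp_def] using this
  have l3 := ENNReal.Tendsto.const_mul (a := K) (ENNReal.Tendsto.mul l1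
    (Or.inr (by finiteness)) l2 (Or.inr (by finiteness))) (Or.inr hK)
  exact (liminf_le_liminf (Eventually.of_forall hle)).trans l3.liminf_eq.le

theorem eLpNorm_ofReal_rpow {α F : Type*} [MeasurableSpace α] {μ : Measure α}
    [NormedAddCommGroup F] {q : ℝ} (hq : 0 < q) (f : α → F) :
    eLpNorm f (ENNReal.ofReal q) μ ^ q = ∫⁻ x, ‖f x‖ₑ ^ q ∂μ := by
  rw [eLpNorm_eq_lintegral_rpow_enorm_toReal (by simpa using hq) ENNReal.ofReal_ne_top,
    ENNReal.toReal_ofReal hq.le, ← ENNReal.rpow_mul, one_div, inv_mul_cancel₀ hq.ne',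
    ENNReal.rpow_one]

/-- Apply the `W^{1,1}` inequality to `|ψ|^t`, which is `C¹` because `t > 1`, then Cauchy-Schwarz to
`|ψ|^(t-1) |∇ψ|`. The exponent `t` remains free, to be matched to the dimension. -/
theorem IsMixedDomain.exists_lintegral_rpow_mul_le {n : ℕ}
    {Ω SD SN : Set (EuclideanSpace ℝ (Fin (n + 1)))} (h : IsMixedDomain Ω SD SN) {p : ℝ}
    (hp : Real.HolderConjugate ((n + 1 : ℕ) : ℝ) p) {t : ℝ} (ht : 1 < t) :
    ∃ C : ℝ≥0, ∀ ψ : EuclideanSpace ℝ (Fin (n + 1)) → ℝ, ContDiff ℝ 1 ψ → (∀ x ∈ SD, ψ x = 0) →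
      ∫⁻ x in Ω, ‖ψ x‖ₑ ^ (t * p) ≤
        C * ((∫⁻ x in Ω, ‖ψ x‖ₑ ^ (2 * (t - 1))) ^ (1 / 2 : ℝ) *
          eLpNorm (∇ ψ) 2 (volume.restrict Ω)) ^ p := by
  obtain ⟨C, hC⟩ := h.exists_lintegral_rpow_le hp
  have h0p : 0 < p := hp.symm.pos
  have ht0 : 0 < t := by linarith
  refine ⟨C * t.toNNReal ^ p, fun ψ hψ hψ0 => ?_⟩
  have hDψ : Measurable fun z => ‖fderiv ℝ ψ z‖ₑ :=
    (hψ.continuous_fderiv one_ne_zero).measurable.enorm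
  have h1 := hC (fun x => ‖ψ x‖ ^ t) (hψ.norm_rpow ht) fun x hx => by
    simp [hψ0 x hx, ht0.ne']
  have h2 : ∀ x, ‖‖ψ x‖ ^ t‖ₑ ^ p = ‖ψ x‖ₑ ^ (t * p) := fun x => by
    rw [Real.enorm_rpow_of_nonneg (norm_nonneg _) ht0.le, enorm_norm, ENNReal.rpow_mul]
  simp_rw [h2] at h1
  refine h1.trans ?_
  rw [ENNReal.coe_mul, ENNReal.coe_rpow_of_nonneg _ h0p.le, mul_assoc,
    ← ENNReal.mul_rpow_of_nonneg _ _ h0p.le]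
  gcongr
  calc ∫⁻ x in Ω, ‖fderiv ℝ (fun x => ‖ψ x‖ ^ t) x‖ₑ
      ≤ ∫⁻ x in Ω, t.toNNReal * (‖ψ x‖ₑ ^ (t - 1) * ‖fderiv ℝ ψ x‖ₑ) := by
        refine lintegral_mono fun x => ?_
        have h3 : (1 : ℝ) < (t.toNNReal : ℝ) := by rwa [Real.coe_toNNReal _ ht0.le]
        have h4 := enorm_fderiv_norm_rpow_le (hψ.differentiable one_ne_zero) (x := x) h3
        rw [Real.coe_toNNReal _ ht0.le] at h4
        rw [← mul_assoc]
        exact h4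
    _ = t.toNNReal * ∫⁻ x in Ω, ‖ψ x‖ₑ ^ (t - 1) * ‖fderiv ℝ ψ x‖ₑ :=
        lintegral_const_mul' _ _ ENNReal.coe_ne_top
    _ ≤ t.toNNReal * ((∫⁻ x in Ω, (‖ψ x‖ₑ ^ (t - 1)) ^ (2 : ℝ)) ^ (1 / 2 : ℝ) *
          (∫⁻ x in Ω, ‖fderiv ℝ ψ x‖ₑ ^ (2 : ℝ)) ^ (1 / 2 : ℝ)) := by
        gcongr
        exact ENNReal.lintegral_mul_le_Lp_mul_Lq _ Real.HolderConjugate.two_two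
          (hψ.continuous.measurable.enorm.pow_const _).aemeasurable hDψ.aemeasurable
    _ = _ := by
        congr 2
        · simp_rw [← ENNReal.rpow_mul]
          rw [mul_comm (2 : ℝ)]
        · rw [eLpNorm_eq_lintegral_rpow_enorm_toReal (by norm_num) (by norm_num)]
          simp [enorm_gradient_eq_enorm_fderiv]

/-- The mixed Sobolev inequality in dimension at least three. -/
theorem IsMixedDomain.exists_mixedSobolevInequality {N : ℕ} (hN : 3 ≤ N)
    {Ω SD SN : Set (EuclideanSpace ℝ (Fin N))} (h : IsMixedDomain Ω SD SN) :
    ∃ κ : ℝ, 0 < κ ∧ MixedSobolevInequality Ω SD κ := by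
  obtain ⟨n, rfl⟩ : ∃ n, N = n + 1 := ⟨N - 1, by omega⟩
  have hn : (2 : ℝ) ≤ n := by
    have : 2 ≤ n := by omega
    exact_mod_cast this
  set p : ℝ := (n + 1) / n with hp
  have hpc : Real.HolderConjugate ((n + 1 : ℕ) : ℝ) p := by
    rw [Real.holderConjugate_iff]
    refine ⟨by push_cast; linarith, ?_⟩
    rw [hp]; push_cast; field_simp; ring
  set q : ℝ := 2 * (n + 1) / (n - 1) with hq
  have hq0 : 0 < q := by
    rw [hq]; apply div_pos <;> linarith
  have hn1 : (n : ℝ) - 1 ≠ 0 := by linarith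
  -- The solution of `t * p = 2 * (t - 1)`; the common value is the critical exponent `q`.
  set t : ℝ := 2 * n / (n - 1) with ht
  have ht1 : 1 < t := by rw [ht, lt_div_iff₀] <;> linarith
  have htp : t * p = q := by rw [ht, hp, hq]; field_simp
  have ht2 : 2 * (t - 1) = q := by rw [ht, hq]; field_simp; ring
  obtain ⟨C, hC⟩ := h.exists_lintegral_rpow_mul_le hpc ht1
  have hp0 : 0 < p := by rw [hp]; positivity
  set B : ℝ≥0 := C ^ (1 / p) with hB
  have hGN : MixedGagliardoNirenberg Ω SD q 0 1 B := by
    refine .of_contDiff ENNReal.coe_ne_top le_rfl zero_le_one fun ψ hψ hψc hψ0 => ?_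
    have h1 := hC ψ hψ hψ0
    rw [htp, ht2, ← eLpNorm_ofReal_rpow hq0] at h1
    simp only [ENNReal.rpow_zero, one_mul, ENNReal.rpow_one]
    set I := eLpNorm ψ (ENNReal.ofReal q) (volume.restrict Ω) with hI
    set D := eLpNorm (∇ ψ) 2 (volume.restrict Ω) with hD
    -- Finiteness, from compact support, allows the factor `I ^ (t - 1)` to be cancelled below.
    have hIt : I ≠ ⊤ := ((hψ.continuous.memLp_of_hasCompactSupport hψc).restrict Ω).2.ne
    rcases eq_or_ne I 0 with hI0 | hI0
    · rw [hI0]; exact zero_le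
    have h2 : I ^ t ≤ B * (I ^ (t - 1) * D) := by
      have h3 := ENNReal.rpow_le_rpow h1 (one_div_nonneg.2 hp0.le)
      rw [ENNReal.mul_rpow_of_nonneg _ _ (one_div_nonneg.2 hp0.le), ← ENNReal.rpow_mul,
        ← ENNReal.rpow_mul, ← ENNReal.rpow_mul, mul_one_div_cancel hp0.ne', ENNReal.rpow_one,
        ← ENNReal.coe_rpow_of_nonneg _ (one_div_nonneg.2 hp0.le)] at h3
      convert h3 using 3
      · rw [← htp]; field_simp
      · rw [← ht2]; ring_nf
    have h4 : I ^ t = I ^ (t - 1) * I := by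
      conv_rhs => rw [← ENNReal.rpow_one I, ← ENNReal.rpow_mul, one_mul, ← ENNReal.rpow_add _ _ hI0 hIt]
      ring_nf
    have h5 : I ^ (t - 1) ≠ 0 := (ENNReal.rpow_pos (pos_iff_ne_zero.2 hI0) hIt).ne'
    have h6 : I ^ (t - 1) ≠ ⊤ := ENNReal.rpow_ne_top_of_nonneg (by linarith) hIt
    rw [h4, mul_left_comm] at h2
    exact (ENNReal.mul_le_mul_iff_right h5 h6).1 h2
  -- `B` may be zero, hence the `+ 1`.
  refine ⟨(B + 1 : ℝ)⁻¹, by positivity, fun u G hu => ?_⟩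
  have h1 := hGN u G hu
  simp only [ENNReal.rpow_zero, one_mul, ENNReal.rpow_one] at h1
  have hqe : 2 * ((n + 1 : ℕ) : ℝ) / (((n + 1 : ℕ) : ℝ) - 2) = q := by
    rw [hq]; push_cast; congr 1; ring
  rw [hqe, ENNReal.ofReal_inv_of_pos (by positivity), mul_comm, ← div_eq_mul_inv]
  refine ENNReal.div_le_of_le_mul (h1.trans ?_)
  rw [mul_comm]
  gcongr
  rw [ENNReal.ofReal_add B.coe_nonneg zero_le_one, ENNReal.ofReal_coe_nnreal]
  exact le_self_add

theorem MixedSobolevInequality.mixedGagliardoNirenberg {κ : ℝ} (hκ : 0 < κ)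
    (h : MixedSobolevInequality Ω SD κ) :
    MixedGagliardoNirenberg Ω SD (2 * N / ((N : ℝ) - 2)) 0 1 (ENNReal.ofReal κ⁻¹) := by
  intro u G hu
  have h1 := h u G hu
  have hκ' : ENNReal.ofReal κ ≠ 0 := by simpa using hκ
  rw [ENNReal.rpow_zero, ENNReal.rpow_one, one_mul, ENNReal.ofReal_inv_of_pos hκ,
    mul_comm (ENNReal.ofReal κ)⁻¹,
    ← div_eq_mul_inv, ENNReal.le_div_iff_mul_le (Or.inl hκ') (Or.inl ENNReal.ofReal_ne_top),
    mul_comm]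
  exact h1

/-- Ladyzhenskaya's inequality for mixed boundary conditions in dimension two. -/
theorem IsMixedDomain.exists_mixedGagliardoNirenberg_two
    {Ω SD SN : Set (EuclideanSpace ℝ (Fin 2))} (h : IsMixedDomain Ω SD SN) :
    ∃ K : ℝ≥0, MixedGagliardoNirenberg Ω SD 4 (1 / 2) (1 / 2) K := by
  have hpc : Real.HolderConjugate ((1 + 1 : ℕ) : ℝ) 2 := by
    have : ((1 + 1 : ℕ) : ℝ) = 2 := by norm_num
    rw [this]; exact Real.HolderConjugate.two_two
  obtain ⟨C, hC⟩ := h.exists_lintegral_rpow_mul_le (n := 1) hpc one_lt_two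
  refine ⟨C ^ (1 / 4 : ℝ), .of_contDiff ENNReal.coe_ne_top (by norm_num) (by norm_num)
    fun ψ hψ hψc hψ0 => ?_⟩
  have h1 := hC ψ hψ hψ0
  have h2 := eLpNorm_ofReal_rpow (μ := volume.restrict Ω) (show (0 : ℝ) < 2 by norm_num) ψ
  rw [show (2 : ℝ) * 2 = 4 by norm_num, show (2 : ℝ) * (2 - 1) = 2 by norm_num, ← h2,
    ← eLpNorm_ofReal_rpow (by norm_num : (0 : ℝ) < 4), ENNReal.ofReal_ofNat 2,
    ← ENNReal.rpow_mul, show (2 : ℝ) * (1 / 2) = 1 by norm_num, ENNReal.rpow_one] at h1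
  have h3 := ENNReal.rpow_le_rpow h1 (show (0 : ℝ) ≤ 1 / 4 by norm_num)
  rw [← ENNReal.rpow_mul, show (4 : ℝ) * (1 / 4) = 1 by norm_num, ENNReal.rpow_one,
    ENNReal.mul_rpow_of_nonneg _ _ (by norm_num), ← ENNReal.rpow_mul,
    show (2 : ℝ) * (1 / 4) = 1 / 2 by norm_num, ENNReal.mul_rpow_of_nonneg _ _ (by norm_num),
    ← ENNReal.coe_rpow_of_nonneg _ (by norm_num)] at h3
  exact h3

end MixedSobolev

/-! ### Smooth truncations of power functions. -/

section TruncatedPower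

open Filter Topology

theorem contDiff_integral_of_contDiff {g : ℝ → ℝ} (hg : ContDiff ℝ ∞ g) :
    ContDiff ℝ ∞ (fun t => ∫ s in (0 : ℝ)..t, g s) ∧
      ∀ t, deriv (fun t => ∫ s in (0 : ℝ)..t, g s) t = g t := by
  have hd : ∀ t, HasDerivAt (fun t => ∫ s in (0 : ℝ)..t, g s) (g t) t := fun t =>
    intervalIntegral.integral_hasDerivAt_right (hg.continuous.intervalIntegrable _ _)
      (hg.continuous.stronglyMeasurableAtFilter _ _) hg.continuous.continuousAt
  have hd' : ∀ t, deriv (fun t => ∫ s in (0 : ℝ)..t, g s) t = g t := fun t => (hd t).deriv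
  refine ⟨contDiff_infty_iff_deriv.2 ⟨fun t => (hd t).differentiableAt, ?_⟩, hd'⟩
  rwa [funext hd']

theorem abs_integral_le_of_abs_le_rpow {g : ℝ → ℝ} {c r : ℝ} (hc : 0 ≤ c) (hr : 0 ≤ r)
    (h : ∀ s, |g s| ≤ c * |s| ^ r) (t : ℝ) : |∫ s in (0 : ℝ)..t, g s| ≤ c * |t| ^ (r + 1) := by
  have h1 := intervalIntegral.norm_integral_le_of_norm_le_const (a := 0) (b := t) (f := g)
    (C := c * |t| ^ r) fun s hs => by
      refine (h s).trans ?_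
      have : |s| ≤ |t| := by
        rcases Set.mem_uIoc.1 hs with h | h
        · rw [abs_of_pos h.1, abs_of_nonneg (h.1.le.trans h.2)]; exact h.2
        · rw [abs_of_nonpos h.2, abs_of_neg (h.1.trans_le h.2)]; linarith [h.1]
      gcongr
  rw [sub_zero] at h1
  refine h1.trans (le_of_eq ?_)
  rcases eq_or_ne t 0 with rfl | ht
  · simp [Real.zero_rpow (by linarith : r + 1 ≠ 0)]
  · rw [Real.rpow_add_one (abs_ne_zero.2 ht), mul_assoc]

theorem abs_integral_mul_abs_rpow {q : ℝ} (hq : 1 ≤ q) (t : ℝ) :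
    |∫ s in (0 : ℝ)..t, q * |s| ^ (q - 1)| = |t| ^ q := by
  have hpos : ∀ t : ℝ, 0 ≤ t → ∫ s in (0 : ℝ)..t, q * |s| ^ (q - 1) = t ^ q := by
    intro t ht
    have h1 : ∫ s in (0 : ℝ)..t, q * |s| ^ (q - 1) = ∫ s in (0 : ℝ)..t, q * s ^ (q - 1) := by
      refine intervalIntegral.integral_congr fun s hs => ?_
      rw [Set.uIcc_of_le ht] at hs
      simp only [abs_of_nonneg hs.1]
    rw [h1, intervalIntegral.integral_const_mul, integral_rpow (Or.inl (by linarith)),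
      sub_add_cancel, Real.zero_rpow (by linarith)]
    field_simp
    ring
  rcases le_total 0 t with ht | ht
  · rw [hpos t ht, abs_of_nonneg ht, abs_of_nonneg (Real.rpow_nonneg ht _)]
  · have h2 := intervalIntegral.integral_comp_neg (a := 0) (b := t)
      (fun s : ℝ => q * |s| ^ (q - 1))
    simp only [abs_neg, neg_zero] at h2
    rw [h2, intervalIntegral.integral_symm, hpos (-t) (by linarith), abs_neg, abs_of_nonpos ht,
      abs_of_nonneg (Real.rpow_nonneg (by linarith) _)]

/-- Smooth approximations of `t ↦ t |t| ^ (q - 1)` with bounded derivative. -/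
theorem exists_contDiff_truncated_power {q : ℝ} (hq : 1 ≤ q) :
    ∃ F : ℕ → ℝ → ℝ, (∀ n, ContDiff ℝ ∞ (F n)) ∧ (∀ n, F n 0 = 0) ∧
      (∀ n, ∃ M : ℝ≥0, ∀ t, ‖deriv (F n) t‖ ≤ M) ∧
      (∀ n t, |deriv (F n) t| ≤ q * |t| ^ (q - 1)) ∧ (∀ n t, |F n t| ≤ q * |t| ^ q) ∧
      ∀ t, Tendsto (fun n => |F n t|) atTop (𝓝 (|t| ^ q)) := by
  have hq0 : 0 ≤ q := by linarith
  have hq1 : 0 ≤ q - 1 := by linarith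
  -- Vanishes where `n t² ≤ 1`, removing the singularity of `|t|^(q-1)` at zero, and where `t² ≥ n`,
  -- making the derivative bounded; it tends to `1` at every `t ≠ 0`.
  let χ : ℕ → ℝ → ℝ := fun n t =>
    Real.smoothTransition (n * t ^ 2 - 1) * Real.smoothTransition (n - t ^ 2)
  have hχ0 : ∀ n t, 0 ≤ χ n t := fun n t =>
    mul_nonneg (Real.smoothTransition.nonneg _) (Real.smoothTransition.nonneg _)
  have hχ1 : ∀ n t, χ n t ≤ 1 := fun n t =>
    mul_le_one₀ (Real.smoothTransition.le_one _) (Real.smoothTransition.nonneg _)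
      (Real.smoothTransition.le_one _)
  have hχs : ∀ n, ContDiff ℝ ∞ (χ n) := fun n =>
    (Real.smoothTransition.contDiff.comp (by fun_prop)).mul
      (Real.smoothTransition.contDiff.comp (by fun_prop))
  let g : ℕ → ℝ → ℝ := fun n t => q * |t| ^ (q - 1) * χ n t
  have hg0 : ∀ n t, 0 ≤ g n t := fun n t => mul_nonneg (by positivity) (hχ0 n t)
  have hgle : ∀ n t, |g n t| ≤ q * |t| ^ (q - 1) := fun n t => by
    rw [abs_of_nonneg (hg0 n t)]
    exact mul_le_of_le_one_right (by positivity) (hχ1 n t)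
  have hgs : ∀ n, ContDiff ℝ ∞ (g n) := by
    intro n
    rw [contDiff_iff_contDiffAt]
    intro t
    by_cases ht : t = 0
    · subst ht
      have hc : Continuous fun t : ℝ => (n : ℝ) * t ^ 2 - 1 := by fun_prop
      have h1 : ∀ᶠ t : ℝ in 𝓝 0, (n : ℝ) * t ^ 2 - 1 < 0 :=
        hc.tendsto' 0 (-1) (by simp) |>.eventually_lt_const (by norm_num)
      have h2 : g n =ᶠ[𝓝 0] fun _ => 0 := by
        filter_upwards [h1] with t ht
        simp [g, χ, Real.smoothTransition.zero_of_nonpos ht.le]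
      exact contDiffAt_const.congr_of_eventuallyEq h2
    · exact (contDiffAt_const.mul ((contDiffAt_abs ht).rpow_const_of_ne (abs_ne_zero.2 ht))).mul
        (hχs n).contDiffAt
  have hgb : ∀ n t, |g n t| ≤ q * (Real.sqrt n) ^ (q - 1) := by
    intro n t
    by_cases ht : t ^ 2 ≤ n
    · refine (hgle n t).trans ?_
      have : |t| ≤ Real.sqrt n := Real.abs_le_sqrt ht
      gcongr
    · have : g n t = 0 := by
        simp [g, χ, Real.smoothTransition.zero_of_nonpos (show (n : ℝ) - t ^ 2 ≤ 0 by linarith)]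
      rw [this, abs_zero]
      positivity
  refine ⟨fun n t => ∫ s in (0 : ℝ)..t, g n s, fun n => (contDiff_integral_of_contDiff (hgs n)).1,
    fun n => intervalIntegral.integral_same, fun n => ⟨(q * (Real.sqrt n) ^ (q - 1)).toNNReal,
      fun t => ?_⟩, fun n t => ?_, fun n t => ?_, fun t => ?_⟩
  · rw [(contDiff_integral_of_contDiff (hgs n)).2 t]
    exact (hgb n t).trans (Real.le_coe_toNNReal _)
  · rw [(contDiff_integral_of_contDiff (hgs n)).2 t]
    exact hgle n t
  · have := abs_integral_le_of_abs_le_rpow hq0 hq1 (hgle n) t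
    rwa [sub_add_cancel] at this
  · rw [← abs_integral_mul_abs_rpow hq t]
    refine (intervalIntegral.tendsto_integral_filter_of_dominated_convergence
      (fun s => q * |s| ^ (q - 1))
      (Eventually.of_forall fun n => (hgs n).continuous.aestronglyMeasurable)
      (Eventually.of_forall fun n => ae_of_all _ fun s _ => hgle n s) ?_ ?_).abs
    · refine Continuous.intervalIntegrable ?_ _ _
      exact continuous_const.mul (continuous_abs.rpow_const fun s => Or.inr hq1)
    · have h0 : ∀ᵐ s : ℝ, s ≠ 0 := by simp [ae_iff]
      filter_upwards [h0] with s hs _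
      refine tendsto_const_nhds.congr' ?_
      have hs2 : 0 < s ^ 2 := by positivity
      filter_upwards [tendsto_natCast_atTop_atTop.eventually_ge_atTop (2 / s ^ 2),
        tendsto_natCast_atTop_atTop.eventually_ge_atTop (s ^ 2 + 1)] with n h1 h2
      rw [div_le_iff₀ hs2] at h1
      simp only [g, χ]
      rw [Real.smoothTransition.one_of_one_le (by linarith),
        Real.smoothTransition.one_of_one_le (by linarith), mul_one, mul_one]

end TruncatedPower

/-! ### Moser iteration as a statement about `L^p` norms. -/

section Iteration

open Filter Topology

variable {α F : Type*} [MeasurableSpace α] [NormedAddCommGroup F]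

/-- Chebyshev: if `b < d < c` and `‖f‖ ≥ c` on a set of measure above `m > 0`, then `(c / d) ^ p ≤ 1
/ m` for arbitrarily large `p`, which is absurd. Taking a finite `m` covers sets of infinite
measure. -/
theorem eLpNorm_top_le_of_tendsto {μ : Measure α} {f : α → F} (hf : AEStronglyMeasurable f μ)
    {p : ℕ → ℝ} (hp : ∀ n, 0 < p n) (hpt : Tendsto p atTop atTop) {B : ℕ → ℝ≥0∞} {b : ℝ≥0∞}
    (hB : Tendsto B atTop (𝓝 b)) (h : ∀ n, eLpNorm f (ENNReal.ofReal (p n)) μ ≤ B n) :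
    eLpNorm f ⊤ μ ≤ b := by
  by_contra! hlt
  obtain ⟨c, hbc, hcf⟩ := ENNReal.lt_iff_exists_nnreal_btwn.1 hlt
  obtain ⟨d, hbd, hdc⟩ := ENNReal.lt_iff_exists_nnreal_btwn.1 hbc
  have hd0 : 0 < d := by exact_mod_cast zero_le.trans_lt hbd
  have hdc' : d < c := by exact_mod_cast hdc
  have hS : μ {x | (c : ℝ≥0∞) ≤ ‖f x‖ₑ} ≠ 0 := by
    intro h0
    refine hcf.not_ge ?_
    rw [eLpNorm_exponent_top]
    refine eLpNormEssSup_le_of_ae_enorm_bound ?_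
    have h1 : ∀ᵐ x ∂μ, ¬ (c : ℝ≥0∞) ≤ ‖f x‖ₑ := by simpa [ae_iff] using h0
    filter_upwards [h1] with x hx using (not_le.1 hx).le
  obtain ⟨m, hm0, hmS⟩ := ENNReal.lt_iff_exists_nnreal_btwn.1 (pos_iff_ne_zero.2 hS)
  have hm0' : 0 < m := by exact_mod_cast hm0
  have hratio : 1 < (c / d : ℝ) := by
    rw [one_lt_div (by exact_mod_cast hd0)]; exact_mod_cast hdc'
  have ht := (tendsto_rpow_atTop_of_base_gt_one _ hratio).comp hpt
  obtain ⟨n, hn1, hn2⟩ :=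
    ((ht.eventually_gt_atTop (1 / m : ℝ)).and (hB.eventually_lt_const hbd)).exists
  have hpn := hp n
  have h2 := mul_meas_ge_le_pow_eLpNorm' μ (p := ENNReal.ofReal (p n)) (by simpa using hpn)
    ENNReal.ofReal_ne_top hf c
  rw [ENNReal.toReal_ofReal hpn.le] at h2
  have h3 : (c : ℝ≥0∞) ^ p n * m ≤ (d : ℝ≥0∞) ^ p n :=
    calc (c : ℝ≥0∞) ^ p n * m ≤ (c : ℝ≥0∞) ^ p n * μ {x | (c : ℝ≥0∞) ≤ ‖f x‖ₑ} := by gcongr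
      _ ≤ _ := h2
      _ ≤ (d : ℝ≥0∞) ^ p n := by
        gcongr
        exact (h n).trans hn2.le
  rw [← ENNReal.coe_rpow_of_nonneg _ hpn.le, ← ENNReal.coe_rpow_of_nonneg _ hpn.le,
    ← ENNReal.coe_mul, ENNReal.coe_le_coe, ← NNReal.coe_le_coe] at h3
  push_cast at h3
  have hdp : (0 : ℝ) < (d : ℝ) ^ p n := Real.rpow_pos_of_pos (by exact_mod_cast hd0) _
  have hmr : (0 : ℝ) < m := by exact_mod_cast hm0'
  simp only [Function.comp_apply] at hn1
  rw [Real.div_rpow c.coe_nonneg d.coe_nonneg, div_lt_div_iff₀ hmr hdp] at hn1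
  linarith

/-- Iteration of reverse Hölder type inequalities. -/
theorem exists_eLpNorm_top_le_of_iterate {χ p₀ : ℝ} (hχ : 1 < χ) (hp₀ : 0 < p₀) :
    ∃ C : ℝ, 0 < C ∧ ∀ (μ : Measure α) (f : α → F) (a : ℝ), AEStronglyMeasurable f μ → 0 < a →
      (∀ p, p₀ ≤ p → eLpNorm f (ENNReal.ofReal (χ * p)) μ ≤
        ENNReal.ofReal ((a * p) ^ (2 / p)) * eLpNorm f (ENNReal.ofReal p) μ) →
      eLpNorm f ⊤ μ ≤ ENNReal.ofReal (C * a ^ (2 / p₀ * (χ / (χ - 1)))) *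
        eLpNorm f (ENNReal.ofReal p₀) μ := by
  have hχ0 : 0 < χ := by linarith
  have hr1 : χ⁻¹ < 1 := inv_lt_one_of_one_lt₀ hχ
  have hr0 : 0 ≤ χ⁻¹ := inv_nonneg.2 hχ0.le
  have hs1 := hasSum_geometric_of_lt_one hr0 hr1
  have hs2 : Summable fun n : ℕ => (n : ℝ) ^ 1 * χ⁻¹ ^ n :=
    summable_pow_mul_geometric_of_norm_lt_one 1 (by rwa [Real.norm_of_nonneg hr0])
  set σ := 2 / p₀ * (χ / (χ - 1)) with hσ
  set τ := ∑' n : ℕ, (n : ℝ) ^ 1 * χ⁻¹ ^ n with hτ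
  refine ⟨p₀ ^ σ * Real.exp (2 / p₀ * Real.log χ * τ),
    mul_pos (Real.rpow_pos_of_pos hp₀ _) (Real.exp_pos _), fun μ f a hf ha hstep => ?_⟩
  let P : ℕ → ℝ := fun n => p₀ * χ ^ n
  have hP : ∀ n, 0 < P n := fun n => by positivity
  have hP₀ : ∀ n, p₀ ≤ P n := fun n => le_mul_of_one_le_right hp₀.le (one_le_pow₀ hχ.le)
  have hPt : Tendsto P atTop atTop :=
    (tendsto_pow_atTop_atTop_of_one_lt hχ).const_mul_atTop hp₀
  -- Logarithm of the `n`-th factor `(a * P n) ^ (2 / P n)`. The geometric part produces the power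
  -- of `a * p₀`; the part with `n * χ⁻¹ ^ n` sums to a constant depending on `χ` and `p₀` only.
  let e : ℕ → ℝ := fun n => 2 / p₀ * Real.log (a * p₀) * χ⁻¹ ^ n +
    2 / p₀ * Real.log χ * ((n : ℝ) ^ 1 * χ⁻¹ ^ n)
  have he : ∀ n, (a * P n) ^ (2 / P n) = Real.exp (e n) := by
    intro n
    rw [Real.rpow_def_of_pos (mul_pos ha (hP n))]
    congr 1
    simp only [P, e]
    rw [← mul_assoc, Real.log_mul (by positivity) (by positivity), Real.log_pow, inv_pow]
    field_simp
  have hsum : HasSum e (2 / p₀ * Real.log (a * p₀) * (1 - χ⁻¹)⁻¹ + 2 / p₀ * Real.log χ * τ) :=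
    (hs1.mul_left _).add (hs2.hasSum.mul_left _)
  have hind : ∀ n, eLpNorm f (ENNReal.ofReal (P n)) μ ≤
      ENNReal.ofReal (Real.exp (∑ i ∈ Finset.range n, e i)) *
        eLpNorm f (ENNReal.ofReal p₀) μ := by
    intro n
    induction n with
    | zero => simp [P]
    | succ n ih =>
      have h1 := hstep (P n) (hP₀ n)
      have h2 : χ * P n = P (n + 1) := by simp only [P]; ring
      rw [h2, he n] at h1
      refine h1.trans ?_
      rw [Finset.sum_range_succ, Real.exp_add (∑ i ∈ Finset.range n, e i),
        mul_comm (Real.exp (∑ i ∈ Finset.range n, e i)),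
        ENNReal.ofReal_mul (Real.exp_pos _).le, mul_assoc]
      gcongr
  have hlim : Tendsto (fun n => ENNReal.ofReal (Real.exp (∑ i ∈ Finset.range n, e i)) *
        eLpNorm f (ENNReal.ofReal p₀) μ) atTop (𝓝 (ENNReal.ofReal (Real.exp
          (2 / p₀ * Real.log (a * p₀) * (1 - χ⁻¹)⁻¹ + 2 / p₀ * Real.log χ * τ)) *
          eLpNorm f (ENNReal.ofReal p₀) μ)) := by
    refine ENNReal.Tendsto.mul_const ?_ (Or.inl ?_)
    · exact ENNReal.tendsto_ofReal
        ((Real.continuous_exp.tendsto _).comp hsum.tendsto_sum_nat)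
    · simpa using Real.exp_pos _
  refine (eLpNorm_top_le_of_tendsto hf hP hPt hlim hind).trans (le_of_eq ?_)
  congr 2
  rw [Real.exp_add, mul_right_comm (p₀ ^ σ), ← Real.mul_rpow hp₀.le ha.le,
    Real.rpow_def_of_pos (mul_pos hp₀ ha)]
  congr 2
  have h1 : (1 - χ⁻¹)⁻¹ = χ / (χ - 1) := by
    have : χ - 1 ≠ 0 := by linarith
    field_simp
  rw [h1, hσ, mul_comm p₀ a]
  ring

/-- A bound by the `L^{p₀}` norm follows from the iteration started at the exponent two also for
`p₀ < 2`, by interpolation. -/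
theorem exists_eLpNorm_top_le {χ p₀ : ℝ} (hχ : 1 < χ) (hp₀ : 0 < p₀) :
    ∃ C : ℝ, 0 < C ∧ ∀ (μ : Measure α) (f : α → F) (a : ℝ), MemLp f 2 μ → 0 < a →
      (∀ p, 2 ≤ p → eLpNorm f (ENNReal.ofReal (χ * p)) μ ≤
        ENNReal.ofReal ((a * p) ^ (2 / p)) * eLpNorm f (ENNReal.ofReal p) μ) →
      eLpNorm f ⊤ μ ≤ ENNReal.ofReal (C * a ^ (2 / p₀ * (χ / (χ - 1)))) *
        eLpNorm f (ENNReal.ofReal p₀) μ := by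
  rcases le_or_gt 2 p₀ with h2 | h2
  · obtain ⟨C, hC, h⟩ := exists_eLpNorm_top_le_of_iterate (α := α) (F := F) hχ hp₀
    exact ⟨C, hC, fun μ f a hf ha hstep => h μ f a hf.1 ha fun p hp => hstep p (h2.trans hp)⟩
  · obtain ⟨C, hC, h⟩ := exists_eLpNorm_top_le_of_iterate (α := α) (F := F) hχ zero_lt_two
    refine ⟨C ^ (2 / p₀), Real.rpow_pos_of_pos hC _, fun μ f a hf ha hstep => ?_⟩
    have h1 := h μ f a hf.1 ha hstep
    rw [ENNReal.ofReal_ofNat] at h1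
    set A := C * a ^ ((2 : ℝ) / 2 * (χ / (χ - 1))) with hA
    have hA0 : 0 ≤ A := by positivity
    set X := eLpNorm f ⊤ μ with hX
    -- The iteration from exponent `2` already gives boundedness, so `X ^ (2 - p₀)` can be cancelled
    -- after interpolation.
    have hXt : X ≠ ⊤ := (h1.trans_lt (ENNReal.mul_lt_top ENNReal.ofReal_lt_top hf.2)).ne
    rcases eq_or_ne X 0 with hX0 | hX0
    · rw [hX0]; exact zero_le
    have h3 : eLpNorm f 2 μ ^ (2 : ℝ) ≤
        X ^ (2 - p₀) * eLpNorm f (ENNReal.ofReal p₀) μ ^ p₀ := by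
      have h4 := eLpNorm_ofReal_rpow (μ := μ) (zero_lt_two (α := ℝ)) f
      rw [ENNReal.ofReal_ofNat] at h4
      rw [h4, eLpNorm_ofReal_rpow hp₀, ← lintegral_const_mul' _ _
        (ENNReal.rpow_ne_top_of_nonneg (by linarith) hXt)]
      refine lintegral_mono_ae ?_
      filter_upwards [ae_le_eLpNormEssSup (f := f) (μ := μ)] with x hx
      rw [← eLpNorm_exponent_top] at hx
      calc ‖f x‖ₑ ^ (2 : ℝ) = ‖f x‖ₑ ^ (2 - p₀) * ‖f x‖ₑ ^ p₀ := by
            rw [← ENNReal.rpow_add_of_nonneg _ _ (by linarith) hp₀.le, sub_add_cancel]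
        _ ≤ _ := by
            gcongr
    have h5 : X ^ (2 - p₀) * X ^ p₀ ≤ X ^ (2 - p₀) *
        (ENNReal.ofReal A ^ (2 : ℝ) * eLpNorm f (ENNReal.ofReal p₀) μ ^ p₀) :=
      calc X ^ (2 - p₀) * X ^ p₀ = X ^ (2 : ℝ) := by
            rw [← ENNReal.rpow_add _ _ hX0 hXt, sub_add_cancel]
        _ ≤ (ENNReal.ofReal A * eLpNorm f 2 μ) ^ (2 : ℝ) := by gcongr
        _ ≤ ENNReal.ofReal A ^ (2 : ℝ) *
            (X ^ (2 - p₀) * eLpNorm f (ENNReal.ofReal p₀) μ ^ p₀) := by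
            rw [ENNReal.mul_rpow_of_nonneg _ _ zero_le_two]
            gcongr
        _ = _ := by ring
    rw [ENNReal.mul_le_mul_iff_right (ENNReal.rpow_pos (pos_iff_ne_zero.2 hX0) hXt).ne'
      (ENNReal.rpow_ne_top_of_nonneg (by linarith) hXt)] at h5
    have h6 := ENNReal.rpow_le_rpow h5 (inv_nonneg.2 hp₀.le)
    rw [ENNReal.mul_rpow_of_nonneg _ _ (inv_nonneg.2 hp₀.le), ← ENNReal.rpow_mul,
      ← ENNReal.rpow_mul, ← ENNReal.rpow_mul, mul_inv_cancel₀ hp₀.ne', ENNReal.rpow_one,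
      ENNReal.rpow_one, ← div_eq_mul_inv, ENNReal.ofReal_rpow_of_nonneg hA0 (by positivity)] at h6
    refine h6.trans (le_of_eq ?_)
    congr 2
    rw [hA, Real.mul_rpow hC.le (by positivity), ← Real.rpow_mul ha.le]
    congr 2
    field_simp

end Iteration

/-! ### Energy estimate and reverse Hölder inequality for solutions. -/

section Moser

open Filter Topology

variable {N : ℕ} {Ω SD : Set (EuclideanSpace ℝ (Fin N))} {lam : ℝ}
  {φ : EuclideanSpace ℝ (Fin N) → ℝ}

/-- The energy estimate for a smooth function of a solution. -/
theorem eLpNorm_deriv_smul_le_of_weak {G : EuclideanSpace ℝ (Fin N) → EuclideanSpace ℝ (Fin N)}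
    (hlam : 0 ≤ lam) (hφ : MemH1Mixed Ω SD φ G)
    (hweak : ∀ (v : EuclideanSpace ℝ (Fin N) → ℝ)
      (H : EuclideanSpace ℝ (Fin N) → EuclideanSpace ℝ (Fin N)), MemH1Mixed Ω SD v H →
      ∫ x in Ω, inner ℝ (G x) (H x) = lam * ∫ x in Ω, φ x * v x)
    {F : ℝ → ℝ} (hF : ContDiff ℝ ∞ F) (hF0 : F 0 = 0) {M : ℝ≥0} (hM : ∀ t, ‖deriv F t‖ ≤ M)
    {q : ℝ} (hq : 1 ≤ q) (hFq : ∀ t, |deriv F t| ≤ q * |t| ^ (q - 1)) :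
    eLpNorm (fun x => deriv F (φ x) • G x) 2 (volume.restrict Ω) ≤
      ENNReal.ofReal (lam ^ (1 / 2 : ℝ) * q) *
        eLpNorm φ (ENNReal.ofReal (2 * q)) (volume.restrict Ω) ^ q := by
  have hq0 : 0 < q := by linarith
  have hF' : ContDiff ℝ ∞ (deriv F) := (contDiff_infty_iff_deriv.1 hF).2
  have hg : ContDiff ℝ ∞ fun t => deriv F t ^ 2 := hF'.pow 2
  obtain ⟨hH, hH'⟩ := contDiff_integral_of_contDiff hg
  -- Since `H' = (F')²`, the test function `H ∘ φ` makes the left side of the weak equation equal to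
  -- the squared `L²` norm of `∇(F ∘ φ)`.
  set H := fun t => ∫ s in (0 : ℝ)..t, deriv F s ^ 2 with hHdef
  have hHM : ∀ t, ‖deriv H t‖ ≤ (M ^ 2 : ℝ≥0) := by
    intro t
    rw [hH', norm_pow]
    push_cast
    exact pow_le_pow_left₀ (norm_nonneg _) (hM t) 2
  have hHq : ∀ t, |H t| ≤ q ^ 2 * |t| ^ (2 * q - 1) := by
    intro t
    have := abs_integral_le_of_abs_le_rpow (g := fun t => deriv F t ^ 2) (c := q ^ 2)
      (r := 2 * q - 2) (by positivity) (by linarith) (fun s => by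
        rw [abs_pow]
        refine (pow_le_pow_left₀ (abs_nonneg _) (hFq s) 2).trans (le_of_eq ?_)
        rw [mul_pow, ← Real.rpow_natCast (|s| ^ (q - 1)), ← Real.rpow_mul (abs_nonneg s)]
        congr 2
        push_cast
        ring) t
    convert this using 3
    ring
  have hv := hweak _ _ (hφ.comp hH intervalIntegral.integral_same hHM)
  have hV := (hφ.comp hF hF0 hM).memH1.memLp_grad
  set V := fun x => deriv F (φ x) • G x with hVdef
  have hVint : Integrable (fun x => ‖V x‖ ^ (2 : ℝ)) (volume.restrict Ω) := by
    simpa using hV.integrable_norm_rpow (by norm_num) (by norm_num)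
  have h1 : ∫ x in Ω, ‖V x‖ ^ (2 : ℝ) = lam * ∫ x in Ω, φ x * H (φ x) := by
    rw [← hv]
    congr 1
    funext x
    rw [hH', real_inner_smul_right, real_inner_self_eq_norm_sq, hVdef]
    simp only [norm_smul, Real.rpow_two, mul_pow, Real.norm_eq_abs, sq_abs]
  have h2 : eLpNorm V 2 (volume.restrict Ω) ^ (2 : ℝ) =
      ENNReal.ofReal (∫ x in Ω, ‖V x‖ ^ (2 : ℝ)) := by
    have h3 := eLpNorm_ofReal_rpow (μ := volume.restrict Ω) (zero_lt_two (α := ℝ)) V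
    rw [ENNReal.ofReal_ofNat] at h3
    rw [h3, ofReal_integral_eq_lintegral_ofReal hVint (Eventually.of_forall fun x => by positivity)]
    refine lintegral_congr fun x => ?_
    rw [← ENNReal.ofReal_rpow_of_nonneg (norm_nonneg _) zero_le_two, ofReal_norm]
  have h4 : ENNReal.ofReal (∫ x in Ω, φ x * H (φ x)) ≤ ENNReal.ofReal (q ^ 2) *
      eLpNorm φ (ENNReal.ofReal (2 * q)) (volume.restrict Ω) ^ (2 * q) := by
    rw [eLpNorm_ofReal_rpow (by positivity), ← lintegral_const_mul' _ _ ENNReal.ofReal_ne_top]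
    calc ENNReal.ofReal (∫ x in Ω, φ x * H (φ x)) ≤ ‖∫ x in Ω, φ x * H (φ x)‖ₑ := by
          rw [← ofReal_norm]
          exact ENNReal.ofReal_le_ofReal (Real.le_norm_self _)
      _ ≤ ∫⁻ x in Ω, ‖φ x * H (φ x)‖ₑ := enorm_integral_le_lintegral_enorm _
      _ ≤ _ := by
          refine lintegral_mono fun x => ?_
          rw [← ofReal_norm, ← ofReal_norm, ENNReal.ofReal_rpow_of_nonneg (norm_nonneg _)
            (by positivity), ← ENNReal.ofReal_mul (by positivity)]
          refine ENNReal.ofReal_le_ofReal ?_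
          rw [norm_mul, Real.norm_eq_abs, Real.norm_eq_abs]
          refine (mul_le_mul_of_nonneg_left (hHq (φ x)) (abs_nonneg _)).trans (le_of_eq ?_)
          have h5 : |φ x| ^ (2 * q) = |φ x| * |φ x| ^ (2 * q - 1) := by
            rcases eq_or_ne (φ x) 0 with h0 | h0
            · rw [h0, abs_zero, Real.zero_rpow (by positivity), zero_mul]
            · rw [mul_comm |φ x|, ← Real.rpow_add_one (abs_ne_zero.2 h0), sub_add_cancel]
          rw [h5]; ring
  have h6 : eLpNorm V 2 (volume.restrict Ω) ^ (2 : ℝ) ≤ ENNReal.ofReal (lam * q ^ 2) *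
      eLpNorm φ (ENNReal.ofReal (2 * q)) (volume.restrict Ω) ^ (2 * q) := by
    rw [h2, h1, ENNReal.ofReal_mul hlam, ENNReal.ofReal_mul hlam, mul_assoc]
    gcongr
  have h7 := ENNReal.rpow_le_rpow h6 (show (0 : ℝ) ≤ 1 / 2 by norm_num)
  rw [ENNReal.mul_rpow_of_nonneg _ _ (by norm_num), ← ENNReal.rpow_mul, ← ENNReal.rpow_mul,
    show (2 : ℝ) * (1 / 2) = 1 by norm_num, ENNReal.rpow_one,
    ENNReal.ofReal_rpow_of_nonneg (by positivity) (by norm_num),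
    show 2 * q * (1 / 2) = q by ring] at h7
  refine h7.trans (le_of_eq ?_)
  congr 2
  rw [Real.mul_rpow hlam (by positivity), ← Real.sqrt_eq_rpow (q ^ 2), Real.sqrt_sq hq0.le]

/-- The reverse Hölder type inequality for solutions. -/
theorem IsMixedEigenSolution.eLpNorm_le (hφ : IsMixedEigenSolution Ω SD lam φ) (hlam : 0 < lam)
    {χ s K : ℝ} (hχ : 0 < χ) (hs0 : 0 ≤ s) (hs1 : s ≤ 1) (hK : 0 < K)
    (hGN : MixedGagliardoNirenberg Ω SD (2 * χ) (1 - s) s (ENNReal.ofReal K)) {p : ℝ}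
    (hp : 2 ≤ p) :
    eLpNorm φ (ENNReal.ofReal (χ * p)) (volume.restrict Ω) ≤
      ENNReal.ofReal ((K * lam ^ (s / 2) * p) ^ (2 / p)) *
        eLpNorm φ (ENNReal.ofReal p) (volume.restrict Ω) := by
  obtain ⟨G, hG, hweak⟩ := hφ
  set μ := volume.restrict Ω with hμ
  have hφm : AEStronglyMeasurable φ μ := hG.memH1.memLp.1
  set q := p / 2 with hqdef
  have hpq : p = 2 * q := by rw [hqdef]; ring
  have hq : 1 ≤ q := by rw [hqdef]; linarith
  have hq0 : 0 < q := by linarith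
  obtain ⟨F, hF, hF0, hFM, hF', hFq, hFt⟩ := exists_contDiff_truncated_power hq
  set X := eLpNorm φ (ENNReal.ofReal p) μ with hX
  have hpow : ∀ r : ℝ, 0 ≤ r → eLpNorm (fun x => ‖φ x‖ ^ q) (ENNReal.ofReal r) μ =
      eLpNorm φ (ENNReal.ofReal (r * q)) μ ^ q := fun r hr => by
    rw [eLpNorm_norm_rpow _ hq0, ENNReal.ofReal_mul hr]
  have hbound : ∀ n, eLpNorm (fun x => |F n (φ x)|) (ENNReal.ofReal (2 * χ)) μ ≤
      ENNReal.ofReal (K * lam ^ (s / 2) * q) * X ^ q := by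
    intro n
    obtain ⟨M, hM⟩ := hFM n
    have h1 := hGN _ _ (hG.comp (hF n) (hF0 n) hM)
    have h2 := eLpNorm_deriv_smul_le_of_weak hlam.le hG hweak (hF n) (hF0 n) hM hq (hF' n)
    rw [← hpq] at h2
    have h3 : eLpNorm (fun x => F n (φ x)) 2 μ ≤ ENNReal.ofReal q * X ^ q := by
      have h4 := hpow 2 zero_le_two
      rw [ENNReal.ofReal_ofNat, ← hpq] at h4
      rw [hX, ← h4]
      refine eLpNorm_le_mul_eLpNorm_of_ae_le_mul (Eventually.of_forall fun x => ?_) 2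
      rw [Real.norm_eq_abs, Real.norm_of_nonneg (by positivity), Real.norm_eq_abs]
      exact hFq n (φ x)
    have h5 : eLpNorm (fun x => |F n (φ x)|) (ENNReal.ofReal (2 * χ)) μ =
        eLpNorm (fun x => F n (φ x)) (ENNReal.ofReal (2 * χ)) μ :=
      eLpNorm_congr_norm_ae (Eventually.of_forall fun x => by simp)
    rw [h5]
    refine h1.trans ?_
    have hs1' : 0 ≤ 1 - s := by linarith
    calc ENNReal.ofReal K * (eLpNorm (fun x => F n (φ x)) 2 μ ^ (1 - s) *
          eLpNorm (fun x => deriv (F n) (φ x) • G x) 2 μ ^ s)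
        ≤ ENNReal.ofReal K * ((ENNReal.ofReal q * X ^ q) ^ (1 - s) *
          (ENNReal.ofReal (lam ^ (1 / 2 : ℝ) * q) * X ^ q) ^ s) := by gcongr
      _ = ENNReal.ofReal K * (ENNReal.ofReal lam ^ (s / 2) *
          ((ENNReal.ofReal q * X ^ q) ^ (1 - s) * (ENNReal.ofReal q * X ^ q) ^ s)) := by
          rw [ENNReal.ofReal_mul (by positivity), mul_assoc (ENNReal.ofReal (lam ^ _)),
            ENNReal.mul_rpow_of_nonneg (ENNReal.ofReal (lam ^ _)) _ hs0,
            ← ENNReal.ofReal_rpow_of_nonneg hlam.le (by norm_num), ← ENNReal.rpow_mul,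
            show 1 / 2 * s = s / 2 by ring]
          ring
      _ = _ := by
          rw [← ENNReal.rpow_add_of_nonneg _ _ hs1' hs0, sub_add_cancel, ENNReal.rpow_one,
            ENNReal.ofReal_mul (by positivity), ENNReal.ofReal_mul hK.le,
            ENNReal.ofReal_rpow_of_nonneg hlam.le (by positivity)]
          ring
  -- The bound does not depend on the truncation, so Fatou's lemma carries it over to `|φ| ^ q`.
  have hlim : eLpNorm (fun x => ‖φ x‖ ^ q) (ENNReal.ofReal (2 * χ)) μ ≤
      ENNReal.ofReal (K * lam ^ (s / 2) * q) * X ^ q := by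
    refine (Lp.eLpNorm_lim_le_liminf_eLpNorm (f := fun n x => |F n (φ x)|) (fun n => ?_) _
      (Eventually.of_forall fun x => hFt (φ x))).trans ?_
    · exact ((hF n).continuous.abs).comp_aestronglyMeasurable hφm
    · exact (liminf_le_liminf (Eventually.of_forall hbound)).trans (by simp)
  rw [hpow _ (by positivity)] at hlim
  have h8 := ENNReal.rpow_le_rpow hlim (inv_nonneg.2 hq0.le)
  rw [ENNReal.mul_rpow_of_nonneg _ _ (inv_nonneg.2 hq0.le), ← ENNReal.rpow_mul, ← ENNReal.rpow_mul,
    mul_inv_cancel₀ hq0.ne', ENNReal.rpow_one, ENNReal.rpow_one,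
    ENNReal.ofReal_rpow_of_nonneg (by positivity) (by positivity)] at h8
  have h9 : 2 * χ * q = χ * p := by rw [hpq]; ring
  have h10 : q⁻¹ = 2 / p := by rw [hqdef]; field_simp
  rw [h9, h10] at h8
  -- Only the harmless enlargement of `q = p / 2` to `p` remains.
  refine h8.trans ?_
  gcongr
  linarith

end Moser

/-! ### Assembly of the three claims. -/

theorem proposition3p2 (N : ℕ) (hN : 2 ≤ N) :
    -- every solution is bounded
    (∀ Ω SD SN : Set (EuclideanSpace ℝ (Fin N)), IsMixedDomain Ω SD SN →
      ∀ lam : ℝ, 0 < lam → ∀ φ : EuclideanSpace ℝ (Fin N) → ℝ,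
        IsMixedEigenSolution Ω SD lam φ → MemLp φ ∞ (volume.restrict Ω)) ∧
    -- the bound, with a constant that is independent of the eigenpair
    (∀ p₀ : ℝ, 1 < p₀ → ∀ Ω SD SN : Set (EuclideanSpace ℝ (Fin N)), IsMixedDomain Ω SD SN →
      ∃ C : ℝ, 0 < C ∧ ∀ lam : ℝ, 0 < lam → ∀ φ : EuclideanSpace ℝ (Fin N) → ℝ,
        IsMixedEigenSolution Ω SD lam φ →
          eLpNorm φ ∞ (volume.restrict Ω) ≤
            ENNReal.ofReal (C * lam ^ ((N : ℝ) / (2 * p₀))) *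
              eLpNorm φ (ENNReal.ofReal p₀) (volume.restrict Ω)) ∧
    -- for `N ≥ 3` the constant depends on `N`, `p₀` and the mixed Sobolev constant only
    (3 ≤ N → ∀ p₀ : ℝ, 1 < p₀ → ∃ C : ℝ, 0 < C ∧
      ∀ Ω SD SN : Set (EuclideanSpace ℝ (Fin N)), IsMixedDomain Ω SD SN →
        (∃ κ : ℝ, 0 < κ ∧ MixedSobolevInequality Ω SD κ) ∧
        ∀ κ : ℝ, 0 < κ → MixedSobolevInequality Ω SD κ →
          ∀ lam : ℝ, 0 < lam → ∀ φ : EuclideanSpace ℝ (Fin N) → ℝ,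
            IsMixedEigenSolution Ω SD lam φ →
              eLpNorm φ ∞ (volume.restrict Ω) ≤
                ENNReal.ofReal (C * (lam / κ ^ 2) ^ ((N : ℝ) / (2 * p₀))) *
                  eLpNorm φ (ENNReal.ofReal p₀) (volume.restrict Ω)) := by
  have part3 : 3 ≤ N → ∀ p₀ : ℝ, 1 < p₀ → ∃ C : ℝ, 0 < C ∧
      ∀ Ω SD SN : Set (EuclideanSpace ℝ (Fin N)), IsMixedDomain Ω SD SN →
        (∃ κ : ℝ, 0 < κ ∧ MixedSobolevInequality Ω SD κ) ∧
        ∀ κ : ℝ, 0 < κ → MixedSobolevInequality Ω SD κ →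
          ∀ lam : ℝ, 0 < lam → ∀ φ : EuclideanSpace ℝ (Fin N) → ℝ,
            IsMixedEigenSolution Ω SD lam φ →
              eLpNorm φ ∞ (volume.restrict Ω) ≤
                ENNReal.ofReal (C * (lam / κ ^ 2) ^ ((N : ℝ) / (2 * p₀))) *
                  eLpNorm φ (ENNReal.ofReal p₀) (volume.restrict Ω) := by
    intro hN3 p₀ hp₀
    have hN3' : (3 : ℝ) ≤ N := by exact_mod_cast hN3
    have hN2 : (0 : ℝ) < (N : ℝ) - 2 := by linarith
    set χ : ℝ := N / ((N : ℝ) - 2) with hχ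
    have hχ1 : 1 < χ := by rw [hχ, one_lt_div hN2]; linarith
    obtain ⟨C, hC, h⟩ := exists_eLpNorm_top_le (α := EuclideanSpace ℝ (Fin N)) (F := ℝ) hχ1
      (zero_lt_one.trans hp₀)
    refine ⟨C, hC, fun Ω SD SN hdom => ⟨hdom.exists_mixedSobolevInequality hN3, ?_⟩⟩
    intro κ hκ hS lam hlam φ hφ
    have hGN := hS.mixedGagliardoNirenberg hκ
    have h2χ : 2 * N / ((N : ℝ) - 2) = 2 * χ := by rw [hχ]; ring
    -- The exponent `0` is rewritten as `1 - 1`, to fit the interpolated form with `s = 1`.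
    rw [h2χ, ← sub_self (1 : ℝ)] at hGN
    have hmem : MemLp φ 2 (volume.restrict Ω) := by
      obtain ⟨G, hG, -⟩ := hφ
      exact hG.memH1.memLp
    have ha : 0 < κ⁻¹ * lam ^ ((1 : ℝ) / 2) := by positivity
    have h1 := h (volume.restrict Ω) φ _ hmem ha fun p hp =>
      hφ.eLpNorm_le hlam (by linarith) zero_le_one le_rfl (by positivity) hGN hp
    refine h1.trans (le_of_eq ?_)
    congr 3
    have h2 : κ⁻¹ * lam ^ ((1 : ℝ) / 2) = (lam / κ ^ 2) ^ ((1 : ℝ) / 2) := by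
      rw [Real.div_rpow hlam.le (by positivity), ← Real.sqrt_eq_rpow (κ ^ 2), Real.sqrt_sq hκ.le]
      ring
    rw [h2, ← Real.rpow_mul (by positivity)]
    congr 1
    have h3 : χ - 1 = 2 / ((N : ℝ) - 2) := by rw [hχ]; field_simp; ring
    rw [h3, hχ]
    field_simp
  have part2 : ∀ p₀ : ℝ, 1 < p₀ → ∀ Ω SD SN : Set (EuclideanSpace ℝ (Fin N)),
      IsMixedDomain Ω SD SN →
      ∃ C : ℝ, 0 < C ∧ ∀ lam : ℝ, 0 < lam → ∀ φ : EuclideanSpace ℝ (Fin N) → ℝ,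
        IsMixedEigenSolution Ω SD lam φ →
          eLpNorm φ ∞ (volume.restrict Ω) ≤
            ENNReal.ofReal (C * lam ^ ((N : ℝ) / (2 * p₀))) *
              eLpNorm φ (ENNReal.ofReal p₀) (volume.restrict Ω) := by
    intro p₀ hp₀ Ω SD SN hdom
    rcases hN.eq_or_lt with rfl | hN3
    · obtain ⟨K, hK⟩ := hdom.exists_mixedGagliardoNirenberg_two
      obtain ⟨C, hC, h⟩ := exists_eLpNorm_top_le (α := EuclideanSpace ℝ (Fin 2)) (F := ℝ)
        one_lt_two (zero_lt_one.trans hp₀)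
      have hK' : MixedGagliardoNirenberg Ω SD (2 * 2) (1 - 1 / 2) (1 / 2)
          (ENNReal.ofReal (K + 1)) := by
        intro u G hu
        have := hK u G hu
        rw [show (2 : ℝ) * 2 = 4 by norm_num, show (1 : ℝ) - 1 / 2 = 1 / 2 by norm_num]
        refine this.trans ?_
        gcongr
        rw [ENNReal.ofReal_add K.coe_nonneg zero_le_one, ENNReal.ofReal_coe_nnreal]
        exact le_self_add
      -- With `χ = 2` the iteration raises `a = (K + 1) * lam ^ (1 / 4)` to the power `4 / p₀`, so
      -- `lam` gets the exponent `1 / p₀ = N / (2 p₀)`.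
      refine ⟨C * ((K : ℝ) + 1) ^ (4 / p₀), by positivity, fun lam hlam φ hφ => ?_⟩
      have hmem : MemLp φ 2 (volume.restrict Ω) := by
        obtain ⟨G, hG, -⟩ := hφ
        exact hG.memH1.memLp
      have h1 := h (volume.restrict Ω) φ _ hmem (by positivity) fun p hp =>
        hφ.eLpNorm_le hlam zero_lt_two (by norm_num) (by norm_num) (by positivity) hK' hp
      refine h1.trans (le_of_eq ?_)
      rw [Real.mul_rpow (by positivity) (by positivity), ← Real.rpow_mul hlam.le, mul_assoc]
      congr 5
      · ring
      · push_cast; ring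
    · obtain ⟨C, hC, h⟩ := part3 hN3 p₀ hp₀
      obtain ⟨⟨κ, hκ, hS⟩, hb⟩ := h Ω SD SN hdom
      refine ⟨C * (1 / κ ^ 2) ^ ((N : ℝ) / (2 * p₀)), by positivity, fun lam hlam φ hφ => ?_⟩
      refine (hb κ hκ hS lam hlam φ hφ).trans (le_of_eq ?_)
      rw [mul_assoc, ← Real.mul_rpow (by positivity) hlam.le]
      congr 4
      ring
  refine ⟨fun Ω SD SN hdom lam hlam φ hφ => ?_, part2, part3⟩
  -- The exponent `2` is chosen because `φ ∈ L²` is part of being a solution.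
  obtain ⟨C, hC, h⟩ := part2 2 one_lt_two Ω SD SN hdom
  have h1 := h lam hlam φ hφ
  obtain ⟨G, hG, -⟩ := hφ
  rw [ENNReal.ofReal_ofNat] at h1
  exact ⟨hG.memH1.memLp.1, h1.trans_lt
    (ENNReal.mul_lt_top ENNReal.ofReal_lt_top hG.memH1.memLp.2)⟩
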